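/- **Setting.** Let $\mu(z)=(1+e^{-z})^{-1}$. A single discrete-time queue is served by $K$ servers with unknown parameters $\theta_1^*,\dots,\theta_K^*\in\mathbb R^d$, $d\ge 1$. At the beginning of round $t=1,2,\dots$ the waiting jobs form the set $\mathcal X_t$, each job having a feature vector in a set $\mathcal X\subset\mathbb R^d$; $Q(t)=|\mathcal X_t|$ (distinct jobs may have equal features), and $Q(1)=q_0$. If $Q(t)\ge 1$, the policy chooses a job with feature $x_t$ in the queue and a server $k_t\in[K]$ using only the information available at the beginning of round $t$; the job leaves if and only if $U_t\le\mu(x_t^{\top}\theta_{k_t}^*)$ (feedback $r_t=1$; otherwise $r_t=0$). If $Q(t)=0$ nothing is served and nothing is observed. Then a new job joins if $A(t)=1$. Here $A(t)\in\{0,1\}$ has mean $\lambda$, $U_t$ is uniform on $[0,1]$, $A(t)$ and $U_t$ are independent, and $(A(t),U_t)$ is independent of the past. Features are chosen by an adversary, without any distributional assumption: the feature of a job arriving in round $t$ may depend on everything that has happened up to the end of round $t$ (for the initial jobs: on the information at the beginning of round 1). **Assumptions.** $\|x\|_2\le 1$ for $x\in\mathcal X$; $\|\theta_k^*\|_2\le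 S$ for all $k$; $\dot\mu(x^{\top}\theta)\ge 1/\kappa$ for all $x\in\mathcal X$ and $\theta\in\Theta:=\{\|\theta\|_2\le S\}$, with $\kappa>0$; and for some $\epsilon>0$, for each $x\in\mathcal X$ there is a server $k$ with $\mu(x^{\top}\theta_k^*)-\lambda\ge\epsilon$. **Algorithm CQB-Opt** (inputs $S,\kappa$, $\lambda_0>0$, $\delta$). Let $I_{t,k}$ be the set of rounds $i\le t$ with $Q(i)\geq 1$ and $k_i=k$, $V_{t,k}=\kappa\lambda_0\mathbf I+\sum_{i\in I_{t,k}}x_ix_i^{\top}$, $\hat\theta^{(1)}_{t,k}=\arg\max_\theta\{\sum_{i\in I_{t,k}}[r_i\log\mu(x_i^{\top}\theta)+(1-r_i)\log(1-\mu(x_i^{\top}\theta))]-\tfrac{\lambda_0}{2}\|\theta\|_2^2\}$, $g_{t,k}(\theta)=\sum_{i\in I_{t,k}}\mu(x_i^{\top}\theta)x_i+\lambda_0\theta$, $\hat\theta_{t,k}\in\arg\min_{\theta\in\Theta}\|g_{t,k}(\theta)-g_{t,k}(\hat\theta^{(1)}_{t,k})\|_{V_{t,k}^{-1}}$ and $$\beta_{t,k}=\frac{\kappa}{2}\sqrt{2d\log\Big(1+\frac{|I_{t,k}|}{\kappa\lambda_0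 d}\Big)+\log(K/\delta)}+\frac{\kappa S\sqrt{\lambda_0}}{2}.$$ In every round $t$ with $Q(t)\ge1$ it chooses $(x_t,k_t)$ maximizing $\mu(x^{\top}\hat\theta_{t-1,k})+\beta_{t-1,k}\|x\|_{V_{t-1,k}^{-1}}$ over the waiting jobs $x$ and $k\in[K]$ (ties, also in the choice of $\hat\theta_{t,k}$, are broken arbitrarily). **Regret.** $R_T=\mathbb E[Q(T)-Q^*(T)]$, where $Q^*$ is the queue length under the optimal policy, which always serves a waiting job and a server in its own queue that maximize $\mu(x^{\top}\theta_k^*)$ (among tied jobs the one that entered first), started from the same initial jobs and exposed to the same arrivals, features and variables $U_t$. (If the features are fixed in advance, $R_T$ depends only on the laws of the two systems and not on sharing $U_t$.) **Theorem.** For all $K,q_0,S,\kappa,\lambda_0$ and $c$ there is a constant $C>0$, depending only on these, such that for all $T\ge 1$, $d\ge 1$, all $\delta$ with $T^{-c}\le\delta\le T^{-1}$ and all systems as above, with any $\epsilon > 0$ and any $\lambda$, CQB-Opt satisfies $$R_T\le C\left(\frac{d^2\log^2T}{\epsilon^{1.5}}+\frac{d\log T}{\epsilon^2}\right).$$ 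-/

import Mathlib

open MeasureTheory ProbabilityTheory
open scoped Matrix

namespace ContextualQueue

noncomputable section

/-- Feature vectors and server parameters, with the Euclidean norm. -/
abbrev Vec (d : ℕ) : Type := EuclideanSpace ℝ (Fin d)

/-- The success probability `μ(xᵀθ)`, with `μ(z) = (1 + exp (-z))⁻¹` the logistic function. -/
def rate {d : ℕ} (θ x : Vec d) : ℝ := Real.sigmoid (inner ℝ x θ)

/-! ### Regularized logistic estimation from a finite sample

The sample consists of the features `z i` and the binary feedback `r i`, for `i ∈ I`. -/

/-- The design matrix `V = κ λ₀ I + ∑ zᵢ zᵢᵀ`. -/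
def design {d : ℕ} (κ lam₀ : ℝ) (I : Finset ℕ) (z : ℕ → Vec d) : Matrix (Fin d) (Fin d) ℝ :=
  (κ * lam₀) • (1 : Matrix (Fin d) (Fin d) ℝ)
    + ∑ i ∈ I, Matrix.vecMulVec (z i).ofLp (z i).ofLp

/-- The weighted norm `‖x‖_{V⁻¹} = √(xᵀ V⁻¹ x)`. -/
def invNorm {d : ℕ} (V : Matrix (Fin d) (Fin d) ℝ) (x : Vec d) : ℝ :=
  Real.sqrt (x.ofLp ⬝ᵥ (V⁻¹ *ᵥ x.ofLp))

/-- The regularized log-likelihood (negative cross-entropy loss). -/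
def regLogLik {d : ℕ} (lam₀ : ℝ) (I : Finset ℕ) (z : ℕ → Vec d) (r : ℕ → ℝ) (θ : Vec d) : ℝ :=
  ∑ i ∈ I, (r i * Real.log (rate θ (z i)) + (1 - r i) * Real.log (1 - rate θ (z i)))
    - lam₀ / 2 * ‖θ‖ ^ 2

/-- The map `g(θ) = ∑ μ(zᵢᵀθ) zᵢ + λ₀ θ`; the gradient of the regularized log-likelihood
is `∑ rᵢ zᵢ - g(θ)`. -/
def gradMap {d : ℕ} (lam₀ : ℝ) (I : Finset ℕ) (z : ℕ → Vec d) (θ : Vec d) : Vec d :=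
  ∑ i ∈ I, rate θ (z i) • z i + lam₀ • θ

/-- `θ` is a projected regularized maximum likelihood estimate: with `θ₁` the maximizer of the
regularized log-likelihood over the whole space, `θ` minimizes `‖g(θ) - g(θ₁)‖_{V⁻¹}` over the
ball of radius `S`. -/
def IsEstimate {d : ℕ} (S κ lam₀ : ℝ) (I : Finset ℕ) (z : ℕ → Vec d) (r : ℕ → ℝ)
    (θ : Vec d) : Prop :=
  ∃ θ₁ : Vec d, (∀ θ' : Vec d, regLogLik lam₀ I z r θ' ≤ regLogLik lam₀ I z r θ₁) ∧
    ‖θ‖ ≤ S ∧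
    ∀ θ' : Vec d, ‖θ'‖ ≤ S →
      invNorm (design κ lam₀ I z) (gradMap lam₀ I z θ - gradMap lam₀ I z θ₁) ≤
        invNorm (design κ lam₀ I z) (gradMap lam₀ I z θ' - gradMap lam₀ I z θ₁)

/-- The confidence radius after `n` observations of a server. -/
def radius (d K : ℕ) (S κ lam₀ δ : ℝ) (n : ℕ) : ℝ :=
  κ / 2 * Real.sqrt (2 * d * Real.log (1 + n / (κ * lam₀ * d)) + Real.log (K / δ))
    + κ * S * Real.sqrt lam₀ / 2

/-! ### The queueing system

Rounds are `t = 1, 2, …`. Jobs carry labels in the order in which they enter: the `q₀` jobs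
present at the beginning of round `1` have the labels `0, …, q₀ - 1`, and the job that arrives
in round `t` (if there is one) has the label `q₀ + t`. -/

/-- A single queue with `K` servers and features that are chosen by an adversary. The σ-algebra
`ℱ t` is the information at the beginning of round `t`. -/
structure Model (d K : ℕ) (Ω : Type*) [mΩ : MeasurableSpace Ω] where
  /-- the underlying probability -/
  P : Measure Ω
  isProb : IsProbabilityMeasure P
  /-- the information at the beginning of each round -/
  ℱ : Filtration ℕ mΩ
  /-- the unknown parameters of the servers -/
  θ : Fin K → Vec d
  /-- the arrival rate -/
  lam : ℝ
  /-- the initial queue length -/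
  q₀ : ℕ
  /-- the feature of each job -/
  feat : ℕ → Ω → Vec d
  /-- whether a job arrives in round `t` -/
  arr : ℕ → Ω → Bool
  /-- the uniform variable that decides about the success of the service in round `t` -/
  srv : ℕ → Ω → ℝ
  /-- The adversary is adaptive: he may use everything that has happened so far. -/
  feat_init : ∀ j < q₀, Measurable[ℱ 1] (feat j)
  feat_arr : ∀ t, 1 ≤ t → Measurable[ℱ (t + 1)] (feat (q₀ + t))
  arr_meas : ∀ t, 1 ≤ t → Measurable[ℱ (t + 1)] (arr t)
  srv_meas : ∀ t, 1 ≤ t → Measurable[ℱ (t + 1)] (srv t)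
  arr_law : ∀ t, 1 ≤ t → P.real {ω | arr t ω = true} = lam
  srv_law : ∀ t, 1 ≤ t → P.map (srv t) = volume.restrict (Set.Icc (0 : ℝ) 1)
  arr_indep_srv : ∀ t, 1 ≤ t → IndepFun (arr t) (srv t) P
  /-- Arrival and service in round `t` are independent of the past. -/
  indep_past : ∀ t, 1 ≤ t →
    Indep (MeasurableSpace.comap (fun ω => (arr t ω, srv t ω)) inferInstance) (ℱ t) P

namespace Model

variable {d K : ℕ} {Ω : Type*} [mΩ : MeasurableSpace Ω]

/-- The standing assumptions: features lie in a set `𝒳` inside the unit ball, the parameters lie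
in the ball of radius `S`, the derivative of the logistic function is at least `1 / κ` at all
relevant arguments, and there is traffic slack `ε`. -/
structure Assumptions (M : Model d K Ω) (𝒳 : Set (Vec d)) (S κ ε : ℝ) : Prop where
  feat_mem : ∀ j ω, M.feat j ω ∈ 𝒳
  norm_feat : ∀ x ∈ 𝒳, ‖x‖ ≤ 1
  norm_param : ∀ k, ‖M.θ k‖ ≤ S
  deriv_lower : ∀ x ∈ 𝒳, ∀ θ : Vec d, ‖θ‖ ≤ S → 1 / κ ≤ deriv Real.sigmoid (inner ℝ x θ)
  slack : ∀ x ∈ 𝒳, ∃ k, ε ≤ rate (M.θ k) x - M.lam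

end Model

/-- The evolution of the queue up to time `T` under some policy that sees, at the beginning of
round `t`, what is contained in `ℱ t`. If the queue is empty then `job t` and `server t` play no
role: there is no departure. -/
structure Run {d K : ℕ} {Ω : Type*} [MeasurableSpace Ω] (M : Model d K Ω) (T : ℕ) where
  /-- the labels of the waiting jobs at the beginning of round `t` -/
  queue : ℕ → Ω → Finset ℕ
  /-- the chosen job -/
  job : ℕ → Ω → ℕ
  /-- the chosen server -/
  server : ℕ → Ω → Fin K
  job_meas : ∀ t, 1 ≤ t → t ≤ T → Measurable[M.ℱ t] (job t)
  server_meas : ∀ t, 1 ≤ t → t ≤ T → Measurable[M.ℱ t] (server t)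
  job_mem : ∀ t, 1 ≤ t → t ≤ T → ∀ ω, (queue t ω).Nonempty → job t ω ∈ queue t ω
  queue_one : ∀ ω, queue 1 ω = Finset.range M.q₀
  /-- The chosen job leaves if the service succeeds, which for a job `x` and a server `k` is the
  event that the uniform variable of the round is at most `μ(xᵀθₖ)`; then the arriving job, if
  any, joins. -/
  queue_succ : ∀ t, 1 ≤ t → t ≤ T → ∀ ω,
    queue (t + 1) ω =
      (if M.srv t ω ≤ rate (M.θ (server t ω)) (M.feat (job t ω) ω)
        then (queue t ω).erase (job t ω) else queue t ω)
      ∪ (if M.arr t ω = true then {M.q₀ + t} else ∅)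

namespace Run

variable {d K : ℕ} {Ω : Type*} [MeasurableSpace Ω] {M : Model d K Ω} {T : ℕ}

/-- The optimal policy: it knows the parameters, serves a job-server pair with the largest
departure rate in its own queue, and among jobs that attain it takes the one that entered
first. -/
def IsOptimal (R : Run M T) : Prop :=
  ∀ t, 1 ≤ t → t ≤ T → ∀ ω, ∀ j ∈ R.queue t ω, ∀ k : Fin K,
    rate (M.θ k) (M.feat j ω) ≤ rate (M.θ (R.server t ω)) (M.feat (R.job t ω) ω) ∧
    (rate (M.θ k) (M.feat j ω) = rate (M.θ (R.server t ω)) (M.feat (R.job t ω) ω) →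
      R.job t ω ≤ j)

/-- The feature of the chosen job. -/
def chosen (R : Run M T) (ω : Ω) (t : ℕ) : Vec d := M.feat (R.job t ω) ω

/-- The binary feedback of a round in which the queue is not empty. -/
def feedback (R : Run M T) (ω : Ω) (t : ℕ) : ℝ :=
  if M.srv t ω ≤ rate (M.θ (R.server t ω)) (R.chosen ω t) then 1 else 0

/-- The rounds up to `t` in which server `k` has worked on a job. -/
def obs (R : Run M T) (ω : Ω) (t : ℕ) (k : Fin K) : Finset ℕ :=
  (Finset.Icc 1 t).filter fun i => (R.queue i ω).Nonempty ∧ R.server i ω = k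

/-- The upper confidence bound of feature `x` at server `k`, computed from the observations up to
round `t` and an estimate `θ` of the parameter of the server. -/
def ucb (R : Run M T) (S κ lam₀ δ : ℝ) (ω : Ω) (t : ℕ) (k : Fin K) (θ x : Vec d) : ℝ :=
  rate θ x + radius d K S κ lam₀ δ (R.obs ω t k).card *
    invNorm (design κ lam₀ (R.obs ω t k) (R.chosen ω)) x

/-- The purely optimistic algorithm CQB-Opt with input `S`, `κ`, `λ₀`, `δ`; `est t k ω` is the
estimate of the parameter of server `k` after round `t`. Ties are broken arbitrarily. -/
def IsCQBOpt (R : Run M T) (S κ lam₀ δ : ℝ) : Prop :=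
  ∃ est : ℕ → Fin K → Ω → Vec d, ∀ t, 1 ≤ t → t ≤ T → ∀ ω,
    (∀ k, IsEstimate S κ lam₀ (R.obs ω (t - 1) k) (R.chosen ω) (R.feedback ω)
      (est (t - 1) k ω)) ∧
    ∀ j ∈ R.queue t ω, ∀ k : Fin K,
      R.ucb S κ lam₀ δ ω (t - 1) k (est (t - 1) k ω) (M.feat j ω) ≤
        R.ucb S κ lam₀ δ ω (t - 1) (R.server t ω) (est (t - 1) (R.server t ω) ω) (R.chosen ω t)

end Run

/-- Queue length regret `R_T = 𝔼[Q(T) - Q*(T)]` of a run against another one that is exposed to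
the same arrivals, features and service noise. -/
def regret {d K : ℕ} {Ω : Type*} [MeasurableSpace Ω] {M : Model d K Ω} {T : ℕ}
    (R Rstar : Run M T) : ℝ :=
  ∫ ω, (((R.queue T ω).card : ℝ) - ((Rstar.queue T ω).card : ℝ)) ∂M.P

end

end ContextualQueue

/-!
The regret is at most the expected queue length `𝔼[Q(T)]` of the algorithm, since the queue of the
optimal policy has nonnegative length. The expected queue length itself obeys the bound, even with
`1 / ε` in place of `1 / ε ^ (3 / 2)` and of `1 / ε ^ 2`; no coupling with the optimal policy is
needed.

*Confidence.* For each server the noise `s = ∑ (rᵢ - μ(xᵢᵀθ)) xᵢ` satisfies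
`𝔼 exp (2 ‖s‖²_{V⁻¹} - 2 log det V) ≤ exp (-2 log det V₀)`. The step of this supermartingale
(`lintegral_exp_selfNormalized_step`) combines the Sherman–Morrison formula, Hoeffding's lemma and
`a / (1 + a) ≤ log (1 + a)`. Markov's inequality gives confidence sets at level `(δ / K)²`, so a
union bound over all rounds and servers costs only `T δ² / K ≤ 1 / T`. Strong monotonicity of the
gradient map turns a bound on `s` into a bound on all predicted rates (`abs_rate_sub_le_radius`).

*Drift.* By optimism, the departure rate in a round with a nonempty queue is at least
`λ + ε - min(1, w)`, where `w` is twice the confidence width of the chosen pair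
(`Run.slack_sub_chosenRate_le`). So the queue has drift at most `-ε + min(1, w)`. Half of the
negative drift controls the martingale part: `exp (ε ∑ (ΔQ - 𝔼 ΔQ - ε / 2))` is a supermartingale
(`lintegral_exp_drift_sum_le`), hence the fluctuation since the last empty round is at most
`2 log T / ε` outside an event of probability `1 / T`. The other half leaves
`min(1, w) - ε / 2 ≤ min(1, w²) / (2 ε)` per round, and by the elliptical potential lemma
(`sum_min_invNorm_sq_le`) the truncated squared widths sum up to `O(d² log² T)`.
-/

namespace ContextualQueue

noncomputable section

/-! ### Quadratic forms of positive definite matrices -/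

section QuadraticForm

variable {n : Type*} {V : Matrix n n ℝ}

lemma transpose_eq_of_posDef (hV : V.PosDef) : Vᵀ = V := by
  rw [← Matrix.conjTranspose_eq_transpose_of_trivial]; exact hV.1

variable [Fintype n]

lemma dotProduct_mulVec_comm_of_posDef (hV : V.PosDef) (x y : n → ℝ) :
    x ⬝ᵥ (V *ᵥ y) = y ⬝ᵥ (V *ᵥ x) := by
  rw [Matrix.dotProduct_mulVec, ← Matrix.mulVec_transpose, transpose_eq_of_posDef hV,
    dotProduct_comm]

lemma dotProduct_mulVec_nonneg (hV : V.PosDef) (x : n → ℝ) : 0 ≤ x ⬝ᵥ (V *ᵥ x) := by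
  simpa using hV.posSemidef.dotProduct_mulVec_nonneg x

lemma dotProduct_mulVec_sq_le (hV : V.PosDef) (x y : n → ℝ) :
    (x ⬝ᵥ (V *ᵥ y)) ^ 2 ≤ (x ⬝ᵥ (V *ᵥ x)) * (y ⬝ᵥ (V *ᵥ y)) := by
  have h : ∀ t : ℝ, 0 ≤ (y ⬝ᵥ (V *ᵥ y)) * (t * t) + (2 * (x ⬝ᵥ (V *ᵥ y))) * t
      + x ⬝ᵥ (V *ᵥ x) := fun t => by
    have := dotProduct_mulVec_nonneg hV (x + t • y)
    simp only [Matrix.mulVec_add, Matrix.mulVec_smul, dotProduct_add, add_dotProduct,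
      smul_dotProduct, dotProduct_smul, smul_eq_mul,
      dotProduct_mulVec_comm_of_posDef hV y x] at this
    linarith
  have := discrim_le_zero h
  rw [discrim] at this
  linarith

variable [DecidableEq n]

/-- The Sherman–Morrison formula. -/
lemma inv_add_vecMulVec_self (hV : V.PosDef) (x : n → ℝ) :
    (V + Matrix.vecMulVec x x)⁻¹ = V⁻¹ - (1 + x ⬝ᵥ (V⁻¹ *ᵥ x))⁻¹ •
      Matrix.vecMulVec (V⁻¹ *ᵥ x) (V⁻¹ *ᵥ x) := by
  have hu : IsUnit V.det := hV.det_pos.ne'.isUnit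
  have ha : 0 < 1 + x ⬝ᵥ (V⁻¹ *ᵥ x) := by
    linarith [dotProduct_mulVec_nonneg hV.inv x]
  apply Matrix.inv_eq_right_inv
  have h1 : Matrix.vecMul x V⁻¹ = V⁻¹ *ᵥ x := by
    rw [← Matrix.mulVec_transpose, transpose_eq_of_posDef hV.inv]
  have h2 : V *ᵥ (V⁻¹ *ᵥ x) = x := by
    rw [Matrix.mulVec_mulVec, Matrix.mul_nonsing_inv _ hu, Matrix.one_mulVec]
  rw [Matrix.mul_sub, Matrix.add_mul, Matrix.mul_nonsing_inv _ hu, Matrix.vecMulVec_mul, h1,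
    Matrix.mul_smul, Matrix.add_mul, Matrix.mul_vecMulVec, h2, Matrix.vecMulVec_mul_vecMulVec,
    Matrix.vecMulVec_smul]
  generalize Matrix.vecMulVec x (V⁻¹ *ᵥ x) = B
  generalize x ⬝ᵥ (V⁻¹ *ᵥ x) = a at *
  have : (1 + a)⁻¹ • (B + a • B) = B := by
    have e : B + a • B = (1 + a) • B := by rw [add_smul, one_smul]
    rw [e, smul_smul, inv_mul_cancel₀ ha.ne', one_smul]
  rw [this]; abel

/-- The matrix determinant lemma for a symmetric rank-one update. -/
lemma det_add_vecMulVec_self (hV : V.PosDef) (x : n → ℝ) :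
    (V + Matrix.vecMulVec x x).det = V.det * (1 + x ⬝ᵥ (V⁻¹ *ᵥ x)) := by
  rw [Matrix.vecMulVec_eq Unit, Matrix.det_add_replicateCol_mul_replicateRow
    hV.det_pos.ne'.isUnit, Matrix.det_unique (n := Unit)]
  congr 1
  rw [Matrix.mul_assoc, ← Matrix.replicateCol_mulVec, Matrix.add_apply,
    Matrix.replicateRow_mul_replicateCol_apply, Matrix.one_apply_eq]

/-- How the form of the inverse matrix changes when `V` and its argument are updated along `x`. -/
lemma quadForm_inv_add_vecMulVec_self (hV : V.PosDef) (x s : n → ℝ) (η : ℝ) :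
    (s + η • x) ⬝ᵥ ((V + Matrix.vecMulVec x x)⁻¹ *ᵥ (s + η • x)) =
      s ⬝ᵥ (V⁻¹ *ᵥ s) + (2 * η * (x ⬝ᵥ (V⁻¹ *ᵥ s)) + η ^ 2 * (x ⬝ᵥ (V⁻¹ *ᵥ x))
        - (x ⬝ᵥ (V⁻¹ *ᵥ s)) ^ 2) / (1 + x ⬝ᵥ (V⁻¹ *ᵥ x)) := by
  have ha : 0 < 1 + x ⬝ᵥ (V⁻¹ *ᵥ x) := by
    linarith [dotProduct_mulVec_nonneg hV.inv x]
  rw [inv_add_vecMulVec_self hV, Matrix.sub_mulVec, Matrix.smul_mulVec, Matrix.vecMulVec_mulVec]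
  simp only [dotProduct_sub, dotProduct_smul, op_smul_eq_smul, Matrix.mulVec_add,
    Matrix.mulVec_smul, dotProduct_add, add_dotProduct, smul_dotProduct, smul_eq_mul]
  rw [dotProduct_comm (V⁻¹ *ᵥ x) s, dotProduct_comm (V⁻¹ *ᵥ x) x,
    dotProduct_mulVec_comm_of_posDef hV.inv s x]
  generalize x ⬝ᵥ (V⁻¹ *ᵥ x) = a at *
  generalize x ⬝ᵥ (V⁻¹ *ᵥ s) = b at *
  field_simp
  ring

/-- The Cauchy–Schwarz inequality for the dual norms of `V⁻¹` and `V`. -/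
lemma dotProduct_sq_le_inv (hV : V.PosDef) (x y : n → ℝ) :
    (x ⬝ᵥ y) ^ 2 ≤ (x ⬝ᵥ (V⁻¹ *ᵥ x)) * (y ⬝ᵥ (V *ᵥ y)) := by
  have hu : IsUnit V.det := hV.det_pos.ne'.isUnit
  have h := dotProduct_mulVec_sq_le hV.inv x (V *ᵥ y)
  have e : V⁻¹ *ᵥ (V *ᵥ y) = y := by
    rw [Matrix.mulVec_mulVec, Matrix.nonsing_inv_mul _ hu, Matrix.one_mulVec]
  rwa [e, dotProduct_comm (V *ᵥ y)] at h

/-- The arithmetic–geometric mean inequality for the eigenvalues of a matrix. -/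
lemma log_det_le_of_posDef [Nonempty n] (hV : V.PosDef) :
    Real.log V.det ≤ Fintype.card n * Real.log (V.trace / Fintype.card n) := by
  have hc : (0 : ℝ) < Fintype.card n := by exact_mod_cast Fintype.card_pos
  have hp := hV.eigenvalues_pos
  have e1 : V.det = ∏ i, hV.1.eigenvalues i := by
    simpa using hV.1.det_eq_prod_eigenvalues
  have e2 : V.trace = ∑ i, hV.1.eigenvalues i := by
    simpa using hV.1.trace_eq_sum_eigenvalues
  have h := Real.geom_mean_le_arith_mean_weighted Finset.univ
    (fun _ : n => (Fintype.card n : ℝ)⁻¹) hV.1.eigenvalues (fun _ _ => by positivity)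
    (by simp) (fun i _ => (hp i).le)
  rw [Real.finsetProd_rpow _ _ fun i _ => (hp i).le, ← e1, ← Finset.mul_sum, ← e2,
    ← div_eq_inv_mul] at h
  have h' := Real.log_le_log (Real.rpow_pos_of_pos hV.det_pos _) h
  rw [Real.log_rpow hV.det_pos, inv_mul_le_iff₀ hc] at h'
  exact h'

end QuadraticForm

/-! ### The design matrix and its weighted norm -/

section Design

variable {d : ℕ} {κ lam₀ : ℝ} {I : Finset ℕ} {z : ℕ → Vec d}

lemma design_posDef (hκ : 0 < κ) (hlam₀ : 0 < lam₀) (I : Finset ℕ) (z : ℕ → Vec d) :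
    (design κ lam₀ I z).PosDef := by
  refine Matrix.PosDef.add_posSemidef ?_ ?_
  · exact Matrix.PosDef.one.smul (mul_pos hκ hlam₀)
  · exact Matrix.posSemidef_sum _ fun i _ => by
      simpa using Matrix.posSemidef_vecMulVec_self_star (R := ℝ) (z i).ofLp

lemma design_insert {t : ℕ} (ht : t ∉ I) :
    design κ lam₀ (insert t I) z =
      design κ lam₀ I z + Matrix.vecMulVec (z t).ofLp (z t).ofLp := by
  rw [design, design, Finset.sum_insert ht, add_assoc, add_comm (Matrix.vecMulVec _ _)]

lemma trace_design : (design κ lam₀ I z).trace = κ * lam₀ * d + ∑ i ∈ I, ‖z i‖ ^ 2 := by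
  simp [design, Matrix.trace_add, Matrix.trace_sum, Matrix.trace_vecMulVec,
    EuclideanSpace.real_norm_sq_eq, dotProduct, ← sq]

lemma det_design_empty : (design κ lam₀ ∅ z).det = (κ * lam₀) ^ d := by
  simp [design]

/-- The volume growth of the design matrix, for features in the unit ball. -/
lemma log_det_design_le (hd : 1 ≤ d) (hκ : 0 < κ) (hlam₀ : 0 < lam₀)
    (hz : ∀ i ∈ I, ‖z i‖ ≤ 1) :
    Real.log (design κ lam₀ I z).det ≤
      Real.log (design κ lam₀ ∅ z).det + d * Real.log (1 + I.card / (κ * lam₀ * d)) := by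
  have : Nonempty (Fin d) := ⟨⟨0, hd⟩⟩
  have hd' : (0 : ℝ) < d := by exact_mod_cast hd
  have hp : 0 < κ * lam₀ := mul_pos hκ hlam₀
  have htr : (design κ lam₀ I z).trace / d ≤ (κ * lam₀) * (1 + I.card / (κ * lam₀ * d)) := by
    rw [trace_design, div_le_iff₀ hd']
    have : ∑ i ∈ I, ‖z i‖ ^ 2 ≤ ∑ i ∈ I, (1 : ℝ) :=
      Finset.sum_le_sum fun i hi => pow_le_one₀ (norm_nonneg _) (hz i hi)
    have e : κ * lam₀ * (1 + I.card / (κ * lam₀ * d)) * d = κ * lam₀ * d + I.card := by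
      field_simp
    rw [e]; simpa using this
  have htp : 0 < (design κ lam₀ I z).trace / d := by
    rw [trace_design]
    have : 0 ≤ ∑ i ∈ I, ‖z i‖ ^ 2 := Finset.sum_nonneg fun i _ => by positivity
    positivity
  calc Real.log (design κ lam₀ I z).det
      ≤ d * Real.log ((design κ lam₀ I z).trace / d) := by
        simpa using log_det_le_of_posDef (design_posDef hκ hlam₀ I z)
    _ ≤ d * Real.log ((κ * lam₀) * (1 + I.card / (κ * lam₀ * d))) := by
        gcongr
    _ = _ := by
        rw [Real.log_mul hp.ne' (by positivity), det_design_empty, Real.log_pow]; ring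

/-- The square of the norm weighted with the inverse of the design matrix. -/
lemma invNorm_design_sq (hκ : 0 < κ) (hlam₀ : 0 < lam₀) (I : Finset ℕ) (z : ℕ → Vec d)
    (x : Vec d) :
    invNorm (design κ lam₀ I z) x ^ 2 = x.ofLp ⬝ᵥ ((design κ lam₀ I z)⁻¹ *ᵥ x.ofLp) :=
  Real.sq_sqrt (dotProduct_mulVec_nonneg (design_posDef hκ hlam₀ I z).inv _)

lemma invNorm_nonneg (V : Matrix (Fin d) (Fin d) ℝ) (x : Vec d) : 0 ≤ invNorm V x :=
  Real.sqrt_nonneg _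

lemma invNorm_neg (V : Matrix (Fin d) (Fin d) ℝ) (x : Vec d) : invNorm V (-x) = invNorm V x := by
  simp [invNorm, Matrix.mulVec_neg]

lemma invNorm_add_le {V : Matrix (Fin d) (Fin d) ℝ} (hV : V.PosDef) (x y : Vec d) :
    invNorm V (x + y) ≤ invNorm V x + invNorm V y := by
  have hx := dotProduct_mulVec_nonneg hV.inv x.ofLp
  have hy := dotProduct_mulVec_nonneg hV.inv y.ofLp
  have h := dotProduct_mulVec_sq_le hV.inv x.ofLp y.ofLp
  have h' := Real.abs_le_sqrt h
  rw [Real.sqrt_mul hx] at h'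
  refine Real.sqrt_le_iff.2 ⟨add_nonneg (invNorm_nonneg _ _) (invNorm_nonneg _ _), ?_⟩
  rw [add_sq, invNorm, invNorm, Real.sq_sqrt hx, Real.sq_sqrt hy]
  simp only [WithLp.ofLp_add, Matrix.mulVec_add, dotProduct_add, add_dotProduct,
    dotProduct_mulVec_comm_of_posDef hV.inv y.ofLp x.ofLp]
  linarith [le_abs_self (x.ofLp ⬝ᵥ (V⁻¹ *ᵥ y.ofLp))]

/-- The elliptical potential lemma: the widths of the features at the times of their addition are
summable up to the logarithmic volume growth. -/
lemma sum_min_invNorm_sq_le (hκ : 0 < κ) (hlam₀ : 0 < lam₀) (n : ℕ) (y : ℕ → Vec d) :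
    ∑ t ∈ Finset.Icc 1 n, min 1 (invNorm (design κ lam₀ (Finset.Icc 1 (t - 1)) y) (y t) ^ 2) ≤
      2 * (Real.log (design κ lam₀ (Finset.Icc 1 n) y).det
        - Real.log (design κ lam₀ ∅ y).det) := by
  induction n with
  | zero => simp
  | succ n ih =>
    have hV := design_posDef hκ hlam₀ (Finset.Icc 1 n) y
    have e : Finset.Icc 1 (n + 1) = insert (n + 1) (Finset.Icc 1 n) := by
      ext i; simp; omega
    have hni : n + 1 ∉ Finset.Icc 1 n := by simp
    rw [e, Finset.sum_insert hni, design_insert hni, det_add_vecMulVec_self hV,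
      Nat.add_sub_cancel, invNorm_design_sq hκ hlam₀]
    have ha := dotProduct_mulVec_nonneg hV.inv (y (n + 1)).ofLp
    rw [Real.log_mul hV.det_pos.ne' (by positivity)]
    generalize (y (n + 1)).ofLp ⬝ᵥ _ = a at *
    -- `min 1 a ≤ 2 a / (1 + a) ≤ 2 log (1 + a)`
    have h1 : 1 - (1 + a)⁻¹ ≤ Real.log (1 + a) := Real.one_sub_inv_le_log_of_pos (by positivity)
    have h2 : min 1 a ≤ 2 * (1 - (1 + a)⁻¹) := by
      have : 2 * (1 - (1 + a)⁻¹) = 2 * a / (1 + a) := by field_simp; ring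
      rw [this, le_div_iff₀ (by positivity)]
      rcases le_total 1 a with h | h
      · rw [min_eq_left h]; linarith
      · rw [min_eq_right h]; nlinarith
    linarith

end Design

/-! ### Accuracy of the projected maximum likelihood estimate -/

section Estimation

variable {d : ℕ} {S κ lam₀ : ℝ} {I : Finset ℕ} {z : ℕ → Vec d} {r : ℕ → ℝ}

lemma rate_nonneg (θ x : Vec d) : 0 ≤ rate θ x := Real.sigmoid_nonneg _

lemma rate_le_one (θ x : Vec d) : rate θ x ≤ 1 := Real.sigmoid_le_one _

lemma deriv_sigmoid_le (a : ℝ) : deriv Real.sigmoid a ≤ 1 / 4 := by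
  rw [Real.deriv_sigmoid]
  nlinarith [sq_nonneg (Real.sigmoid a - 1 / 2)]

lemma exists_sigmoid_sub_eq (a b : ℝ) :
    ∃ u ∈ Set.Icc (0 : ℝ) 1, Real.sigmoid b - Real.sigmoid a =
      deriv Real.sigmoid (a + u * (b - a)) * (b - a) := by
  have hc : Continuous fun u : ℝ => Real.sigmoid (a + u * (b - a)) :=
    continuous_sigmoid.comp (by fun_prop)
  have hd : ∀ u : ℝ, HasDerivAt (fun u : ℝ => Real.sigmoid (a + u * (b - a)))
      (deriv Real.sigmoid (a + u * (b - a)) * (b - a)) u := fun u => by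
    have h1 : HasDerivAt (fun u : ℝ => a + u * (b - a)) (b - a) u := by
      simpa using ((hasDerivAt_id u).mul_const (b - a)).const_add a
    exact (differentiable_sigmoid _).hasDerivAt.comp u h1
  obtain ⟨u, hu, he⟩ := exists_hasDerivAt_eq_slope _ _ zero_lt_one hc.continuousOn
    fun u _ => hd u
  exact ⟨u, ⟨hu.1.le, hu.2.le⟩, by rw [he]; simp⟩

lemma abs_rate_sub_le (θ θ' x : Vec d) :
    |rate θ x - rate θ' x| ≤ 1 / 4 * |inner ℝ x (θ - θ')| := by
  obtain ⟨u, -, h⟩ := exists_sigmoid_sub_eq (inner ℝ x θ') (inner ℝ x θ)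
  rw [rate, rate, h, abs_mul, inner_sub_right]
  gcongr
  rw [abs_of_nonneg]
  · exact deriv_sigmoid_le _
  · rw [Real.deriv_sigmoid]
    exact mul_nonneg (Real.sigmoid_nonneg _) (sub_nonneg.2 (Real.sigmoid_le_one _))

/-- The first-order condition for the regularized maximum likelihood estimate. -/
lemma gradMap_eq_of_isMax {θ₁ : Vec d}
    (h : ∀ θ' : Vec d, regLogLik lam₀ I z r θ' ≤ regLogLik lam₀ I z r θ₁) :
    gradMap lam₀ I z θ₁ = ∑ i ∈ I, r i • z i := by
  suffices hs : ∀ v : Vec d, inner ℝ (∑ i ∈ I, r i • z i - gradMap lam₀ I z θ₁) v = 0 by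
    exact (sub_eq_zero.1 (inner_self_eq_zero.1 (hs _))).symm
  intro v
  have hlin : ∀ x : Vec d, HasDerivAt (fun u : ℝ => (inner ℝ x (θ₁ + u • v) : ℝ))
      (inner ℝ x v) 0 := fun x => by
    simp only [inner_add_right, inner_smul_right]
    simpa using ((hasDerivAt_id (0 : ℝ)).mul_const (inner ℝ x v)).const_add (inner ℝ x θ₁)
  have hrate : ∀ x : Vec d, HasDerivAt (fun u : ℝ => rate (θ₁ + u • v) x)
      (rate θ₁ x * (1 - rate θ₁ x) * inner ℝ x v) 0 := fun x => by
    have h0 := (Real.hasDerivAt_sigmoid (inner ℝ x (θ₁ + (0 : ℝ) • v))).comp (0 : ℝ) (hlin x)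
    exact h0.congr_deriv (by simp [rate])
  have hd : HasDerivAt (fun u : ℝ => regLogLik lam₀ I z r (θ₁ + u • v))
      (∑ i ∈ I, (r i - rate θ₁ (z i)) * inner ℝ (z i) v - lam₀ * inner ℝ θ₁ v) 0 := by
    unfold regLogLik
    refine HasDerivAt.sub (HasDerivAt.fun_sum fun i _ => ?_) ?_
    · have hp : rate (θ₁ + (0 : ℝ) • v) (z i) ≠ 0 := (Real.sigmoid_pos _).ne'
      have hq : 1 - rate (θ₁ + (0 : ℝ) • v) (z i) ≠ 0 :=
        (sub_pos.2 (Real.sigmoid_lt_one _)).ne'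
      have h1 := ((hrate (z i)).log hp).const_mul (r i)
      have h2 := (((hrate (z i)).const_sub 1).log hq).const_mul (1 - r i)
      refine (h1.add h2).congr_deriv ?_
      simp only [zero_smul, add_zero] at hp hq ⊢
      field_simp
      ring
    · have hn : HasDerivAt (fun u : ℝ => ‖θ₁ + u • v‖ ^ 2) (2 * inner ℝ θ₁ v) 0 := by
        have h1 : HasDerivAt (fun u : ℝ => θ₁ + u • v) v 0 := by
          simpa using ((hasDerivAt_id (0 : ℝ)).smul_const v).const_add θ₁
        simpa using h1.norm_sq
      exact (hn.const_mul (lam₀ / 2)).congr_deriv (by ring)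
  have hmax : IsLocalMax (fun u : ℝ => regLogLik lam₀ I z r (θ₁ + u • v)) 0 :=
    Filter.Eventually.of_forall fun u => by simpa using h (θ₁ + u • v)
  have h0 := hmax.hasDerivAt_eq_zero hd
  rw [← h0]
  simp only [gradMap, inner_sub_left, inner_add_left, sum_inner, real_inner_smul_left, sub_mul,
    Finset.sum_sub_distrib]
  ring

lemma ofLp_dotProduct (x y : Vec d) : x.ofLp ⬝ᵥ y.ofLp = inner ℝ x y := by
  simp [PiLp.inner_apply, dotProduct, mul_comm]

lemma dotProduct_design_mulVec (x : Vec d) :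
    x.ofLp ⬝ᵥ (design κ lam₀ I z *ᵥ x.ofLp) =
      κ * lam₀ * ‖x‖ ^ 2 + ∑ i ∈ I, (inner ℝ (z i) x) ^ 2 := by
  rw [design, Matrix.add_mulVec, dotProduct_add, Matrix.smul_mulVec, Matrix.one_mulVec,
    dotProduct_smul, Matrix.sum_mulVec, dotProduct_sum, ofLp_dotProduct,
    real_inner_self_eq_norm_sq, smul_eq_mul]
  congr 1
  refine Finset.sum_congr rfl fun i _ => ?_
  rw [Matrix.vecMulVec_mulVec, op_smul_eq_smul, dotProduct_smul, ofLp_dotProduct,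
    ofLp_dotProduct, real_inner_comm, smul_eq_mul, sq]

lemma abs_inner_le_invNorm_mul (hκ : 0 < κ) (hlam₀ : 0 < lam₀) (x y : Vec d) :
    |inner ℝ x y| ≤ invNorm (design κ lam₀ I z) x *
      Real.sqrt (y.ofLp ⬝ᵥ (design κ lam₀ I z *ᵥ y.ofLp)) := by
  have hV := design_posDef hκ hlam₀ I z
  rw [invNorm, ← Real.sqrt_mul (dotProduct_mulVec_nonneg hV.inv _), ← ofLp_dotProduct]
  exact Real.abs_le_sqrt (dotProduct_sq_le_inv hV _ _)

/-- Since `V ≥ κ λ₀ I`, the norm weighted with `V⁻¹` is at most a multiple of the Euclidean one. -/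
lemma invNorm_design_le (hκ : 0 < κ) (hlam₀ : 0 < lam₀) (x : Vec d) :
    invNorm (design κ lam₀ I z) x ≤ ‖x‖ / Real.sqrt (κ * lam₀) := by
  have hV := design_posDef hκ hlam₀ I z
  have hp : 0 < κ * lam₀ := mul_pos hκ hlam₀
  set V := design κ lam₀ I z
  set y : Vec d := WithLp.toLp 2 (V⁻¹ *ᵥ x.ofLp) with hy
  have e : V *ᵥ y.ofLp = x.ofLp := by
    rw [hy, Matrix.mulVec_mulVec, Matrix.mul_nonsing_inv _ hV.det_pos.ne'.isUnit,
      Matrix.one_mulVec]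
  have h1 : κ * lam₀ * ‖y‖ ^ 2 ≤ inner ℝ x y := by
    have h := dotProduct_design_mulVec (κ := κ) (lam₀ := lam₀) (I := I) (z := z) y
    change y.ofLp ⬝ᵥ (V *ᵥ y.ofLp) = _ at h
    rw [e, ofLp_dotProduct, real_inner_comm] at h
    rw [h]
    exact le_add_of_nonneg_right (Finset.sum_nonneg fun i _ => sq_nonneg _)
  have h2 : inner ℝ x y ≤ ‖x‖ * ‖y‖ := real_inner_le_norm x y
  have h3 : invNorm V x = Real.sqrt (inner ℝ x y) := by rw [invNorm, ← ofLp_dotProduct]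
  rw [h3, le_div_iff₀ (Real.sqrt_pos.2 hp), ← Real.sqrt_mul' _ hp.le]
  refine Real.sqrt_le_iff.2 ⟨norm_nonneg _, ?_⟩
  -- `κ λ₀ ‖y‖ ≤ ‖x‖` and `⟪x, y⟫ ≤ ‖x‖ ‖y‖`
  have h4 : κ * lam₀ * ‖y‖ ≤ ‖x‖ := by
    rcases (norm_nonneg y).eq_or_lt with h0 | h0
    · rw [← h0]; simp
    · refine le_of_mul_le_mul_right ?_ h0
      linarith
  nlinarith [norm_nonneg x, norm_nonneg y, mul_le_mul_of_nonneg_right h2 hp.le]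

/-- The map `g` is strongly monotone with respect to `V / κ` on the ball of radius `S`, which turns
a bound on `g(θ) - g(θ')` into one on `θ - θ'`. -/
lemma sqrt_quadForm_sub_le (hκ : 0 < κ) (hlam₀ : 0 < lam₀) {θ θ' : Vec d}
    (hθ : ‖θ‖ ≤ S) (hθ' : ‖θ'‖ ≤ S)
    (hderiv : ∀ i ∈ I, ∀ v : Vec d, ‖v‖ ≤ S → 1 / κ ≤ deriv Real.sigmoid (inner ℝ (z i) v)) :
    Real.sqrt ((θ - θ').ofLp ⬝ᵥ (design κ lam₀ I z *ᵥ (θ - θ').ofLp)) ≤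
      κ * invNorm (design κ lam₀ I z) (gradMap lam₀ I z θ - gradMap lam₀ I z θ') := by
  set q := (θ - θ').ofLp ⬝ᵥ (design κ lam₀ I z *ᵥ (θ - θ').ofLp) with hq
  have hq0 : 0 ≤ q := dotProduct_mulVec_nonneg (design_posDef hκ hlam₀ I z) _
  have h1 : q ≤ κ * inner ℝ (gradMap lam₀ I z θ - gradMap lam₀ I z θ') (θ - θ') := by
    have e : gradMap lam₀ I z θ - gradMap lam₀ I z θ' =
        ∑ i ∈ I, (rate θ (z i) - rate θ' (z i)) • z i + lam₀ • (θ - θ') := by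
      simp only [gradMap, sub_smul, Finset.sum_sub_distrib, smul_sub]
      abel
    rw [hq, dotProduct_design_mulVec, e, inner_add_left, sum_inner, real_inner_smul_left,
      real_inner_self_eq_norm_sq, mul_add, Finset.mul_sum, add_comm]
    refine add_le_add (Finset.sum_le_sum fun i hi => ?_) (by rw [mul_assoc])
    obtain ⟨u, hu, h⟩ := exists_sigmoid_sub_eq (inner ℝ (z i) θ') (inner ℝ (z i) θ)
    have hn : ‖θ' + u • (θ - θ')‖ ≤ S := by
      have := (convex_closedBall (0 : Vec d) S).add_smul_sub_mem
        (mem_closedBall_zero_iff.2 hθ') (mem_closedBall_zero_iff.2 hθ) hu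
      exact mem_closedBall_zero_iff.1 this
    have hα := hderiv i hi _ hn
    rw [inner_add_right, inner_smul_right, inner_sub_right] at hα
    rw [real_inner_smul_left, rate, rate, h, ← inner_sub_right]
    rw [← inner_sub_right] at hα
    rw [div_le_iff₀ hκ] at hα
    nlinarith [sq_nonneg (inner ℝ (z i) (θ - θ') : ℝ), mul_le_mul_of_nonneg_right hα
      (sq_nonneg (inner ℝ (z i) (θ - θ') : ℝ))]
  have h2 := abs_inner_le_invNorm_mul (I := I) (z := z) hκ hlam₀
    (gradMap lam₀ I z θ - gradMap lam₀ I z θ') (θ - θ')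
  rw [← hq] at h2
  rcases hq0.eq_or_lt with h0 | h0
  · rw [← h0, Real.sqrt_zero]
    exact mul_nonneg hκ.le (invNorm_nonneg _ _)
  · refine le_of_mul_le_mul_right ?_ (Real.sqrt_pos.2 h0)
    rw [Real.mul_self_sqrt hq0, mul_assoc]
    exact h1.trans (mul_le_mul_of_nonneg_left ((le_abs_self _).trans h2) hκ.le)

/-- If the noise `∑ (rᵢ - μ(zᵢᵀθ)) zᵢ` is small in the norm weighted with `V⁻¹`, then all predicted
rates are within the confidence radius of the rates under the true parameter `θ`. -/
lemma abs_rate_sub_le_radius {K : ℕ} {δ : ℝ} (hd : 1 ≤ d) (hκ : 1 ≤ κ) (hlam₀ : 0 < lam₀)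
    {θhat θ : Vec d} (hest : IsEstimate S κ lam₀ I z r θhat) (hθ : ‖θ‖ ≤ S)
    (hz : ∀ i ∈ I, ‖z i‖ ≤ 1)
    (hderiv : ∀ i ∈ I, ∀ v : Vec d, ‖v‖ ≤ S → 1 / κ ≤ deriv Real.sigmoid (inner ℝ (z i) v))
    (hconf : invNorm (design κ lam₀ I z) (∑ i ∈ I, (r i - rate θ (z i)) • z i) ^ 2 ≤
      Real.log (design κ lam₀ I z).det - Real.log (design κ lam₀ ∅ z).det
        + Real.log (K / δ)) (x : Vec d) :
    |rate θhat x - rate θ x| ≤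
      radius d K S κ lam₀ δ I.card * invNorm (design κ lam₀ I z) x := by
  have hκ0 : 0 < κ := by linarith
  have hV := design_posDef hκ0 hlam₀ I z
  obtain ⟨θ₁, hmax, hS, hproj⟩ := hest
  have hdet := log_det_design_le hd hκ0 hlam₀ hz
  set V := design κ lam₀ I z
  set s := ∑ i ∈ I, (r i - rate θ (z i)) • z i with hs
  set L := Real.log (1 + I.card / (κ * lam₀ * d)) with hL
  have hL0 : 0 ≤ d * L := mul_nonneg d.cast_nonneg (Real.log_nonneg (by
    have : (0 : ℝ) ≤ I.card / (κ * lam₀ * d) := by positivity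
    linarith))
  have hsq : invNorm V s ≤ Real.sqrt (2 * d * L + Real.log (K / δ)) :=
    Real.le_sqrt_of_sq_le (by linarith)
  have hg : gradMap lam₀ I z θ - gradMap lam₀ I z θ₁ = -s + lam₀ • θ := by
    rw [gradMap_eq_of_isMax hmax, gradMap, hs]
    simp only [sub_smul, Finset.sum_sub_distrib]
    abel
  have hreg : invNorm V (lam₀ • θ) ≤ S * Real.sqrt lam₀ := by
    refine (invNorm_design_le hκ0 hlam₀ _).trans ?_
    rw [norm_smul, Real.norm_of_nonneg hlam₀.le, div_le_iff₀ (by positivity)]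
    have h1 : Real.sqrt lam₀ ≤ Real.sqrt (κ * lam₀) := Real.sqrt_le_sqrt (by nlinarith)
    calc lam₀ * ‖θ‖ ≤ lam₀ * S := by gcongr
      _ = S * Real.sqrt lam₀ * Real.sqrt lam₀ := by
        rw [mul_assoc, Real.mul_self_sqrt hlam₀.le, mul_comm]
      _ ≤ _ := by
        have : 0 ≤ S := (norm_nonneg _).trans hθ
        gcongr
  have hgrad : invNorm V (gradMap lam₀ I z θ - gradMap lam₀ I z θ₁) ≤
      Real.sqrt (2 * d * L + Real.log (K / δ)) + S * Real.sqrt lam₀ := by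
    rw [hg]
    refine (invNorm_add_le hV _ _).trans ?_
    rw [invNorm_neg]
    exact add_le_add hsq hreg
  have hdiff : invNorm V (gradMap lam₀ I z θhat - gradMap lam₀ I z θ) ≤
      2 * (Real.sqrt (2 * d * L + Real.log (K / δ)) + S * Real.sqrt lam₀) := by
    have e : gradMap lam₀ I z θhat - gradMap lam₀ I z θ =
        (gradMap lam₀ I z θhat - gradMap lam₀ I z θ₁)
          + -(gradMap lam₀ I z θ - gradMap lam₀ I z θ₁) := by abel
    rw [e]
    refine (invNorm_add_le hV _ _).trans ?_
    rw [invNorm_neg]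
    linarith [hproj θ hθ]
  have hx0 := invNorm_nonneg V x
  calc |rate θhat x - rate θ x|
      ≤ 1 / 4 * |inner ℝ x (θhat - θ)| := abs_rate_sub_le _ _ _
    _ ≤ 1 / 4 * (invNorm V x * (κ * (2 * (Real.sqrt (2 * d * L + Real.log (K / δ))
          + S * Real.sqrt lam₀)))) := by
        gcongr
        refine (abs_inner_le_invNorm_mul (I := I) (z := z) hκ0 hlam₀ x _).trans ?_
        gcongr
        exact (sqrt_quadForm_sub_le hκ0 hlam₀ hS hθ hderiv).trans (by gcongr)
    _ = radius d K S κ lam₀ δ I.card * invNorm V x := by rw [radius]; ring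

end Estimation

/-! ### Measurability of quadratic forms of the inverse -/

section Measurability

variable {Ω : Type*}

lemma measurable_rate {d : ℕ} {m : MeasurableSpace Ω} {x θ : Ω → Vec d} (hx : Measurable x)
    (hθ : Measurable θ) : Measurable fun ω => rate (θ ω) (x ω) :=
  continuous_sigmoid.measurable.comp (hx.inner hθ)

variable {n : Type*} [Fintype n] [DecidableEq n]

lemma measurable_det {m : MeasurableSpace Ω} {V : Ω → Matrix n n ℝ}
    (hV : ∀ i j, Measurable fun ω => V ω i j) : Measurable fun ω => (V ω).det := by
  simp only [Matrix.det_apply]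
  exact Finset.measurable_sum _ fun σ _ =>
    (Finset.measurable_prod _ fun i _ => hV _ _).const_smul _

lemma measurable_inv_apply {m : MeasurableSpace Ω} {V : Ω → Matrix n n ℝ}
    (hV : ∀ i j, Measurable fun ω => V ω i j) (i j : n) :
    Measurable fun ω => (V ω)⁻¹ i j := by
  simp only [Matrix.inv_def, Matrix.smul_apply, Ring.inverse_eq_inv', smul_eq_mul,
    Matrix.adjugate_apply]
  refine (measurable_det hV).inv.mul (measurable_det fun k l => ?_)
  simp only [Matrix.updateRow_apply]
  split_ifs
  · exact measurable_const
  · exact hV k l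

lemma measurable_quadForm_inv {m : MeasurableSpace Ω} {V : Ω → Matrix n n ℝ} {x y : Ω → n → ℝ}
    (hV : ∀ i j, Measurable fun ω => V ω i j) (hx : ∀ i, Measurable fun ω => x ω i)
    (hy : ∀ i, Measurable fun ω => y ω i) :
    Measurable fun ω => x ω ⬝ᵥ ((V ω)⁻¹ *ᵥ y ω) := by
  simp only [dotProduct, Matrix.mulVec]
  exact Finset.measurable_sum _ fun i _ => (hx i).mul
    (Finset.measurable_sum _ fun j _ => (measurable_inv_apply hV i j).mul (hy j))

lemma measurable_design {d : ℕ} {m : MeasurableSpace Ω} {κ lam₀ : ℝ} {I : Finset ℕ}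
    {y : ℕ → Ω → Vec d} (hy : ∀ i ∈ I, Measurable (y i)) (j k : Fin d) :
    Measurable fun ω => design κ lam₀ I (fun i => y i ω) j k := by
  simp only [design, Matrix.add_apply, Matrix.sum_apply, Matrix.vecMulVec_apply]
  refine measurable_const.add (Finset.measurable_sum _ fun i hi => ?_)
  have h := hy i hi
  fun_prop

end Measurability

/-! ### One round of arrival and service -/

section OneRound

variable {Ω : Type*} [mΩ : MeasurableSpace Ω]

lemma lintegral_exp_centered_le {P : Measure Ω} [IsProbabilityMeasure P] {X : Ω → ℝ} {a b m : ℝ}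
    (hX : Measurable X) (hab : ∀ ω, X ω ∈ Set.Icc a b) (hm : P[X] = m) (s : ℝ) :
    ∫⁻ ω, ENNReal.ofReal (Real.exp (s * (X ω - m))) ∂P ≤
      ENNReal.ofReal (Real.exp (((b - a) / 2) ^ 2 * s ^ 2 / 2)) := by
  have h := hasSubgaussianMGF_of_mem_Icc hX.aemeasurable (Filter.Eventually.of_forall hab)
    (μ := P)
  rw [hm] at h
  rw [← ofReal_integral_eq_lintegral_ofReal (h.integrable_exp_mul s)
    (Filter.Eventually.of_forall fun _ => (Real.exp_pos _).le)]
  refine ENNReal.ofReal_le_ofReal ((h.mgf_le s).trans_eq ?_)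
  simp [div_pow, sq_abs]

lemma lintegral_le_of_indepFun {E F : Type*} [MeasurableSpace E] [MeasurableSpace F]
    {P : Measure Ω} [IsProbabilityMeasure P] {W : Ω → E} {ζ : Ω → F} (hW : Measurable W)
    (hζ : Measurable ζ) (hi : IndepFun W ζ P) {f : E × F → ENNReal} (hf : Measurable f)
    {g : Ω → ENNReal} (h : ∀ ω, ∫⁻ ω', f (W ω, ζ ω') ∂P ≤ g ω) :
    ∫⁻ ω, f (W ω, ζ ω) ∂P ≤ ∫⁻ ω, g ω ∂P := by
  have : IsProbabilityMeasure (P.map ζ) := Measure.isProbabilityMeasure_map hζ.aemeasurable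
  rw [← lintegral_map (f := f) hf (hW.prodMk hζ),
    (indepFun_iff_map_prod_eq_prod_map_map hW.aemeasurable hζ.aemeasurable).1 hi,
    lintegral_prod _ hf.aemeasurable, lintegral_map hf.lintegral_prod_right' hW]
  refine lintegral_mono fun ω => ?_
  exact (lintegral_map (hf.comp measurable_prodMk_left) hζ).trans_le (h ω)

namespace Model

variable {d K : ℕ} (M : Model d K Ω)

/-- The centered outcome of a service attempt in round `t` with success probability `ρ`. -/
def noise (t : ℕ) (ρ : ℝ) (ω : Ω) : ℝ := (if M.srv t ω ≤ ρ then 1 else 0) - ρ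

/-- The indicator of an arrival in round `t`. -/
def arrival (t : ℕ) (ω : Ω) : ℝ := if M.arr t ω = true then 1 else 0

variable {M} {t : ℕ}

lemma integral_service (ht : 1 ≤ t) {ρ : ℝ} (hρ : ρ ∈ Set.Icc (0 : ℝ) 1) :
    ∫ ω, (if M.srv t ω ≤ ρ then (1 : ℝ) else 0) ∂M.P = ρ := by
  have := M.isProb
  have hU : Measurable (M.srv t) := (M.srv_meas t ht).mono (M.ℱ.le _) le_rfl
  have hs : MeasurableSet {ω | M.srv t ω ≤ ρ} := measurableSet_le hU measurable_const
  have e : (fun ω => if M.srv t ω ≤ ρ then (1 : ℝ) else 0) =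
      {ω | M.srv t ω ≤ ρ}.indicator 1 := by
    ext ω; simp [Set.indicator_apply]
  rw [e, integral_indicator_one hs]
  have h : M.P {ω | M.srv t ω ≤ ρ} = ENNReal.ofReal ρ := by
    have := congrArg (fun ν => ν (Set.Iic ρ)) (M.srv_law t ht)
    simp only [Measure.map_apply hU measurableSet_Iic,
      Measure.restrict_apply measurableSet_Iic] at this
    have e2 : Set.Iic ρ ∩ Set.Icc (0 : ℝ) 1 = Set.Icc 0 ρ := by
      ext u; simp only [Set.mem_inter_iff, Set.mem_Iic, Set.mem_Icc]
      have := hρ.2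
      constructor
      · rintro ⟨h1, h2, -⟩; exact ⟨h2, h1⟩
      · rintro ⟨h1, h2⟩; exact ⟨h2, h1, by linarith⟩
    rw [e2, Real.volume_Icc, sub_zero] at this
    exact this
  rw [measureReal_def, h, ENNReal.toReal_ofReal hρ.1]

lemma integral_arrival (ht : 1 ≤ t) : ∫ ω, M.arrival t ω ∂M.P = M.lam := by
  have hA : Measurable (M.arr t) := (M.arr_meas t ht).mono (M.ℱ.le _) le_rfl
  have hs : MeasurableSet {ω | M.arr t ω = true} := hA (measurableSet_singleton true)
  have e : M.arrival t = {ω | M.arr t ω = true}.indicator 1 := by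
    ext ω; simp [Set.indicator_apply, arrival]
  rw [e, integral_indicator_one hs, M.arr_law t ht]

lemma lintegral_exp_noise_le (ht : 1 ≤ t) {ρ : ℝ} (hρ : ρ ∈ Set.Icc (0 : ℝ) 1) (s : ℝ) :
    ∫⁻ ω, ENNReal.ofReal (Real.exp (s * M.noise t ρ ω)) ∂M.P ≤
      ENNReal.ofReal (Real.exp (s ^ 2 / 8)) := by
  have := M.isProb
  have hU : Measurable (M.srv t) := (M.srv_meas t ht).mono (M.ℱ.le _) le_rfl
  have hX : Measurable fun ω => if M.srv t ω ≤ ρ then (1 : ℝ) else 0 :=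
    Measurable.ite (measurableSet_le hU measurable_const) measurable_const measurable_const
  refine (lintegral_exp_centered_le (a := 0) (b := 1) hX (fun ω => ?_)
    (integral_service ht hρ) s).trans_eq ?_
  · split_ifs <;> simp
  · congr 2; ring

lemma lintegral_exp_drift_le (ht : 1 ≤ t) {ρ : ℝ} (hρ : ρ ∈ Set.Icc (0 : ℝ) 1) (s : ℝ) :
    ∫⁻ ω, ENNReal.ofReal (Real.exp (s * (M.arrival t ω - M.lam - M.noise t ρ ω))) ∂M.P ≤
      ENNReal.ofReal (Real.exp (s ^ 2 / 2)) := by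
  have := M.isProb
  have hU : Measurable (M.srv t) := (M.srv_meas t ht).mono (M.ℱ.le _) le_rfl
  have hA : Measurable (M.arr t) := (M.arr_meas t ht).mono (M.ℱ.le _) le_rfl
  have hX : Measurable fun ω => if M.srv t ω ≤ ρ then (1 : ℝ) else 0 :=
    Measurable.ite (measurableSet_le hU measurable_const) measurable_const measurable_const
  have hY : Measurable (M.arrival t) :=
    Measurable.ite (hA (measurableSet_singleton true)) measurable_const measurable_const
  have h01 : ∀ ω, (if M.srv t ω ≤ ρ then (1 : ℝ) else 0) ∈ Set.Icc (0 : ℝ) 1 := fun ω => by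
    split_ifs <;> simp
  have h01' : ∀ ω, M.arrival t ω ∈ Set.Icc (0 : ℝ) 1 := fun ω => by
    rw [arrival]; split_ifs <;> simp
  have hint : ∫ ω, (M.arrival t ω - if M.srv t ω ≤ ρ then (1 : ℝ) else 0) ∂M.P
      = M.lam - ρ := by
    rw [integral_sub, integral_arrival ht, integral_service ht hρ]
    · exact Integrable.of_mem_Icc 0 1 hY.aemeasurable (Filter.Eventually.of_forall h01')
    · exact Integrable.of_mem_Icc 0 1 hX.aemeasurable (Filter.Eventually.of_forall h01)
  have h := lintegral_exp_centered_le (a := -1) (b := 1) (hY.sub hX) (fun ω => ?_) hint s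
  · convert h using 5 with ω
    · simp only [noise, Pi.sub_apply]; ring
    · ring
  · have h1 := h01 ω
    have h2 := h01' ω
    simp only [Set.mem_Icc, Pi.sub_apply] at h1 h2 ⊢
    constructor <;> linarith

/-- Integration over round `t` with the information at its beginning held fixed. -/
lemma lintegral_le_of_past (ht : 1 ≤ t) {E : Type*} [MeasurableSpace E] {W : Ω → E}
    (hW : Measurable[M.ℱ t] W) {f : E × (Bool × ℝ) → ENNReal} (hf : Measurable f)
    {g : Ω → ENNReal} (h : ∀ ω, ∫⁻ ω', f (W ω, (M.arr t ω', M.srv t ω')) ∂M.P ≤ g ω) :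
    ∫⁻ ω, f (W ω, (M.arr t ω, M.srv t ω)) ∂M.P ≤ ∫⁻ ω, g ω ∂M.P := by
  have := M.isProb
  have hU : Measurable (M.srv t) := (M.srv_meas t ht).mono (M.ℱ.le _) le_rfl
  have hA : Measurable (M.arr t) := (M.arr_meas t ht).mono (M.ℱ.le _) le_rfl
  refine lintegral_le_of_indepFun (hW.mono (M.ℱ.le _) le_rfl) (hA.prodMk hU) ?_ hf h
  rw [IndepFun_iff_Indep]
  exact (indep_of_indep_of_le_right (M.indep_past t ht) hW.comap_le).symm

end Model

end OneRound

/-! ### Exponential supermartingales -/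

section Supermartingale

variable {Ω : Type*} [mΩ : MeasurableSpace Ω] {d K : ℕ} {M : Model d K Ω}

/-- One step of the self-normalized process: with `η` the noise of round `t`, `a = ‖x‖²_{V⁻¹}` and
`b = xᵀ V⁻¹ s`, the increment `2 Δ‖s‖²_{V⁻¹} - 2 Δ log det V` does not increase the exponential
moment. The part of the increment that is quadratic in `η` is absorbed by the determinant, the
linear part is controlled by Hoeffding's lemma and absorbed by the term in `b²`. -/
lemma lintegral_exp_selfNormalized_step {t : ℕ} (ht : 1 ≤ t) {Z a b ρ : Ω → ℝ}
    (hZ : Measurable[M.ℱ t] Z) (ha : Measurable[M.ℱ t] a) (hb : Measurable[M.ℱ t] b)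
    (hρ : Measurable[M.ℱ t] ρ) (ha0 : ∀ ω, 0 ≤ a ω) (hρ01 : ∀ ω, ρ ω ∈ Set.Icc (0 : ℝ) 1) :
    ∫⁻ ω, ENNReal.ofReal (Real.exp (Z ω + 2 * ((2 * M.noise t (ρ ω) ω * b ω
        + M.noise t (ρ ω) ω ^ 2 * a ω - b ω ^ 2) / (1 + a ω)) - 2 * Real.log (1 + a ω))) ∂M.P ≤
      ∫⁻ ω, ENNReal.ofReal (Real.exp (Z ω)) ∂M.P := by
  obtain ⟨η, hη⟩ : ∃ η : (ℝ × ℝ × ℝ × ℝ) × (Bool × ℝ) → ℝ,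
      η = fun p => (if p.2.2 ≤ p.1.2.2.2 then 1 else 0) - p.1.2.2.2 := ⟨_, rfl⟩
  have hηm : Measurable η := by
    rw [hη]
    refine Measurable.sub (Measurable.ite (measurableSet_le ?_ ?_) measurable_const
      measurable_const) ?_ <;> fun_prop
  have hf : Measurable fun p : (ℝ × ℝ × ℝ × ℝ) × (Bool × ℝ) =>
      ENNReal.ofReal (Real.exp (p.1.1 + 2 * ((2 * η p * p.1.2.2.1
        + η p ^ 2 * p.1.2.1 - p.1.2.2.1 ^ 2) / (1 + p.1.2.1))
        - 2 * Real.log (1 + p.1.2.1))) := by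
    fun_prop
  rw [hη] at hf
  refine Model.lintegral_le_of_past ht (W := fun ω => (Z ω, a ω, b ω, ρ ω))
    (hZ.prodMk (ha.prodMk (hb.prodMk hρ))) hf fun ω => ?_
  have hp : 0 < 1 + a ω := by linarith [ha0 ω]
  have key : ∀ ω', Real.exp (Z ω + 2 * ((2 * M.noise t (ρ ω) ω' * b ω
        + M.noise t (ρ ω) ω' ^ 2 * a ω - b ω ^ 2) / (1 + a ω)) - 2 * Real.log (1 + a ω)) ≤
      Real.exp (Z ω - 2 * b ω ^ 2 / (1 + a ω)) *
        Real.exp (4 * b ω / (1 + a ω) * M.noise t (ρ ω) ω') := fun ω' => by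
    rw [← Real.exp_add]
    refine Real.exp_le_exp.2 ?_
    have hn : M.noise t (ρ ω) ω' ^ 2 ≤ 1 := by
      have := hρ01 ω
      rw [sq_le_one_iff_abs_le_one, abs_le, Model.noise]
      split_ifs <;> constructor <;> linarith [this.1, this.2]
    have hlog : a ω / (1 + a ω) ≤ Real.log (1 + a ω) := by
      refine le_trans (le_of_eq ?_) (Real.one_sub_inv_le_log_of_pos hp)
      field_simp; ring
    have h2 : M.noise t (ρ ω) ω' ^ 2 * (a ω / (1 + a ω)) ≤ a ω / (1 + a ω) :=
      mul_le_of_le_one_left (div_nonneg (ha0 ω) hp.le) hn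
    have e : 2 * ((2 * M.noise t (ρ ω) ω' * b ω + M.noise t (ρ ω) ω' ^ 2 * a ω - b ω ^ 2)
        / (1 + a ω)) = 4 * b ω / (1 + a ω) * M.noise t (ρ ω) ω'
        + 2 * (M.noise t (ρ ω) ω' ^ 2 * (a ω / (1 + a ω))) - 2 * b ω ^ 2 / (1 + a ω) := by
      field_simp; ring
    rw [e]; linarith
  calc _ ≤ ∫⁻ ω', ENNReal.ofReal (Real.exp (Z ω - 2 * b ω ^ 2 / (1 + a ω))) *
        ENNReal.ofReal (Real.exp (4 * b ω / (1 + a ω) * M.noise t (ρ ω) ω')) ∂M.P :=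
      lintegral_mono fun ω' => by
        rw [← ENNReal.ofReal_mul (Real.exp_pos _).le]
        exact ENNReal.ofReal_le_ofReal (key ω')
    _ = ENNReal.ofReal (Real.exp (Z ω - 2 * b ω ^ 2 / (1 + a ω))) *
        ∫⁻ ω', ENNReal.ofReal (Real.exp (4 * b ω / (1 + a ω) * M.noise t (ρ ω) ω')) ∂M.P :=
      lintegral_const_mul' _ _ ENNReal.ofReal_ne_top
    _ ≤ ENNReal.ofReal (Real.exp (Z ω - 2 * b ω ^ 2 / (1 + a ω))) *
        ENNReal.ofReal (Real.exp ((4 * b ω / (1 + a ω)) ^ 2 / 8)) := by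
      gcongr
      exact Model.lintegral_exp_noise_le ht (hρ01 ω) _
    _ ≤ ENNReal.ofReal (Real.exp (Z ω)) := by
      rw [← ENNReal.ofReal_mul (Real.exp_pos _).le, ← Real.exp_add]
      refine ENNReal.ofReal_le_ofReal (Real.exp_le_exp.2 ?_)
      have e : (4 * b ω / (1 + a ω)) ^ 2 / 8 = 2 * b ω ^ 2 / (1 + a ω) / (1 + a ω) := by
        field_simp; ring
      have : 2 * b ω ^ 2 / (1 + a ω) / (1 + a ω) ≤ 2 * b ω ^ 2 / (1 + a ω) :=
        div_le_self (by positivity) (by linarith [ha0 ω])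
      rw [e]; linarith

/-- The sum of noise times feature over the first `n` rounds, for features `y` and success
probabilities given by the parameter `θ`. -/
def noiseSum (M : Model d K Ω) (θ : Vec d) (y : ℕ → Ω → Vec d) (n : ℕ) (ω : Ω) : Vec d :=
  ∑ i ∈ Finset.Icc 1 n, M.noise i (rate θ (y i ω)) ω • y i ω

lemma measurable_noise {t : ℕ} (ht : 1 ≤ t) {ρ : Ω → ℝ} (hρ : Measurable[M.ℱ t] ρ) :
    Measurable[M.ℱ (t + 1)] fun ω => M.noise t (ρ ω) ω := by
  have h := hρ.mono (M.ℱ.mono (Nat.le_succ t)) le_rfl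
  exact (Measurable.ite (measurableSet_le (M.srv_meas t ht) h) measurable_const
    measurable_const).sub h

lemma measurable_design_past {κ lam₀ : ℝ} {y : ℕ → Ω → Vec d} {n : ℕ}
    (hy : ∀ t, 1 ≤ t → t ≤ n → Measurable[M.ℱ t] (y t)) (j k : Fin d) :
    Measurable[M.ℱ (n + 1)] fun ω => design κ lam₀ (Finset.Icc 1 n) (fun i => y i ω) j k := by
  refine measurable_design (fun i hi => ?_) j k
  rw [Finset.mem_Icc] at hi
  exact (hy i hi.1 hi.2).mono (M.ℱ.mono (by omega)) le_rfl

lemma measurable_noiseSum {θ : Vec d} {y : ℕ → Ω → Vec d} {n : ℕ}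
    (hy : ∀ t, 1 ≤ t → t ≤ n → Measurable[M.ℱ t] (y t)) :
    Measurable[M.ℱ (n + 1)] (noiseSum M θ y n) := by
  refine Finset.measurable_sum _ fun i hi => ?_
  rw [Finset.mem_Icc] at hi
  have hyi := hy i hi.1 hi.2
  refine Measurable.smul (M := ℝ) ?_ (hyi.mono (M.ℱ.mono (by omega)) le_rfl)
  exact (measurable_noise hi.1 (measurable_rate hyi measurable_const)).mono (M.ℱ.mono (by omega)) le_rfl

lemma measurable_selfNormalized_exponent {κ lam₀ : ℝ} (hκ : 0 < κ) (hlam₀ : 0 < lam₀)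
    {θ : Vec d} {y : ℕ → Ω → Vec d} {n : ℕ}
    (hy : ∀ t, 1 ≤ t → t ≤ n → Measurable[M.ℱ t] (y t)) :
    Measurable[M.ℱ (n + 1)] fun ω =>
      2 * invNorm (design κ lam₀ (Finset.Icc 1 n) fun i => y i ω) (noiseSum M θ y n ω) ^ 2
        - 2 * Real.log (design κ lam₀ (Finset.Icc 1 n) fun i => y i ω).det := by
  have hD := measurable_design_past (κ := κ) (lam₀ := lam₀) hy
  have hs := measurable_noiseSum (θ := θ) hy
  have hsc : ∀ j, Measurable[M.ℱ (n + 1)] fun ω => (noiseSum M θ y n ω).ofLp j :=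
    fun j => by fun_prop
  simp only [invNorm_design_sq hκ hlam₀]
  exact ((measurable_quadForm_inv hD hsc hsc).const_mul 2).sub
    ((measurable_det hD).log.const_mul 2)

/-- The self-normalized exponential supermartingale of a predictable sequence of features. -/
lemma lintegral_exp_selfNormalized_le {κ lam₀ : ℝ} (hκ : 0 < κ) (hlam₀ : 0 < lam₀) (θ : Vec d)
    {y : ℕ → Ω → Vec d} (n : ℕ) (hy : ∀ t, 1 ≤ t → t ≤ n → Measurable[M.ℱ t] (y t)) :
    ∫⁻ ω, ENNReal.ofReal (Real.exp (2 * invNorm (design κ lam₀ (Finset.Icc 1 n) fun i => y i ω)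
        (noiseSum M θ y n ω) ^ 2
        - 2 * Real.log (design κ lam₀ (Finset.Icc 1 n) fun i => y i ω).det)) ∂M.P ≤
      ENNReal.ofReal (Real.exp (-(2 * Real.log ((κ * lam₀) ^ d)))) := by
  have := M.isProb
  induction n with
  | zero => simp [noiseSum, invNorm, det_design_empty]
  | succ n ih =>
    refine le_trans (le_trans (le_of_eq ?_) (lintegral_exp_selfNormalized_step (M := M)
      (t := n + 1) (by omega)
      (Z := fun ω => 2 * invNorm (design κ lam₀ (Finset.Icc 1 n) fun i => y i ω)
        (noiseSum M θ y n ω) ^ 2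
        - 2 * Real.log (design κ lam₀ (Finset.Icc 1 n) fun i => y i ω).det)
      (a := fun ω => (y (n + 1) ω).ofLp ⬝ᵥ
        ((design κ lam₀ (Finset.Icc 1 n) fun i => y i ω)⁻¹ *ᵥ (y (n + 1) ω).ofLp))
      (b := fun ω => (y (n + 1) ω).ofLp ⬝ᵥ
        ((design κ lam₀ (Finset.Icc 1 n) fun i => y i ω)⁻¹ *ᵥ (noiseSum M θ y n ω).ofLp))
      (ρ := fun ω => rate θ (y (n + 1) ω)) ?_ ?_ ?_ ?_ ?_ ?_))
      (ih fun t h1 h2 => hy t h1 (by omega))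
    · refine lintegral_congr fun ω => ?_
      have hV := design_posDef hκ hlam₀ (Finset.Icc 1 n) fun i => y i ω
      have e : Finset.Icc 1 (n + 1) = insert (n + 1) (Finset.Icc 1 n) := by
        ext i; simp; omega
      have hni : n + 1 ∉ Finset.Icc 1 n := by simp
      have es : noiseSum M θ y (n + 1) ω = noiseSum M θ y n ω
          + M.noise (n + 1) (rate θ (y (n + 1) ω)) ω • y (n + 1) ω := by
        rw [noiseSum, e, Finset.sum_insert hni, noiseSum, add_comm]
      have ha := dotProduct_mulVec_nonneg hV.inv (y (n + 1) ω).ofLp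
      rw [invNorm_design_sq hκ hlam₀, invNorm_design_sq hκ hlam₀, es, e, design_insert hni,
        WithLp.ofLp_add, WithLp.ofLp_smul, quadForm_inv_add_vecMulVec_self hV,
        det_add_vecMulVec_self hV, Real.log_mul hV.det_pos.ne' (by positivity)]
      congr 2
      ring
    all_goals
      have hy1 : Measurable[M.ℱ (n + 1)] (y (n + 1)) := hy _ (by omega) le_rfl
      have hyn : ∀ t, 1 ≤ t → t ≤ n → Measurable[M.ℱ t] (y t) :=
        fun t h1 h2 => hy t h1 (by omega)
      have hD := measurable_design_past (κ := κ) (lam₀ := lam₀) hyn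
      have hs := measurable_noiseSum (θ := θ) hyn
      have hyc : ∀ j, Measurable[M.ℱ (n + 1)] fun ω => (y (n + 1) ω).ofLp j :=
        fun j => by fun_prop
      have hsc : ∀ j, Measurable[M.ℱ (n + 1)] fun ω => (noiseSum M θ y n ω).ofLp j :=
        fun j => by fun_prop
    · exact measurable_selfNormalized_exponent hκ hlam₀ hyn
    · exact measurable_quadForm_inv hD hyc hyc
    · exact measurable_quadForm_inv hD hyc hsc
    · exact measurable_rate hy1 measurable_const
    · exact fun ω => dotProduct_mulVec_nonneg (design_posDef hκ hlam₀ _ _).inv _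
    · exact fun ω => ⟨rate_nonneg _ _, rate_le_one _ _⟩

/-- The self-normalized concentration inequality at level `p²`. -/
lemma measure_selfNormalized_gt_le {κ lam₀ : ℝ} (hκ : 0 < κ) (hlam₀ : 0 < lam₀) (θ : Vec d)
    {y : ℕ → Ω → Vec d} (n : ℕ) (hy : ∀ t, 1 ≤ t → t ≤ n → Measurable[M.ℱ t] (y t))
    {p : ℝ} (hp : 0 < p) :
    M.P {ω | Real.log (design κ lam₀ (Finset.Icc 1 n) fun i => y i ω).det
        - Real.log ((κ * lam₀) ^ d) + Real.log (1 / p) <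
        invNorm (design κ lam₀ (Finset.Icc 1 n) fun i => y i ω) (noiseSum M θ y n ω) ^ 2} ≤
      ENNReal.ofReal (p ^ 2) := by
  set D₀ := Real.log ((κ * lam₀) ^ d)
  have hm := ((measurable_selfNormalized_exponent hκ hlam₀ (θ := θ) hy).mono (M.ℱ.le _)
    le_rfl).exp.ennreal_ofReal
  set F : Ω → ENNReal := _
  have hc : 0 < Real.exp (-(2 * D₀) + 2 * Real.log (1 / p)) := Real.exp_pos _
  calc _ ≤ M.P {ω | ENNReal.ofReal (Real.exp (-(2 * D₀) + 2 * Real.log (1 / p))) ≤ F ω} := by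
        refine measure_mono fun ω hω => ENNReal.ofReal_le_ofReal (Real.exp_le_exp.2 ?_)
        rw [Set.mem_ofPred_eq] at hω
        linarith
    _ ≤ (∫⁻ ω, F ω ∂M.P) / ENNReal.ofReal (Real.exp (-(2 * D₀) + 2 * Real.log (1 / p))) :=
        meas_ge_le_lintegral_div hm.aemeasurable (by simpa using hc) ENNReal.ofReal_ne_top
    _ ≤ ENNReal.ofReal (Real.exp (-(2 * D₀))) /
          ENNReal.ofReal (Real.exp (-(2 * D₀) + 2 * Real.log (1 / p))) := by
        gcongr
        exact lintegral_exp_selfNormalized_le hκ hlam₀ θ n hy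
    _ = ENNReal.ofReal (p ^ 2) := by
        rw [← ENNReal.ofReal_div_of_pos hc, ← Real.exp_sub]
        congr 1
        rw [one_div, Real.log_inv, ← Real.exp_log (pow_pos hp 2), Real.log_pow]
        congr 1
        push_cast
        ring

/-- The exponential supermartingale for the drift of the queue: `g` indicates the rounds that count
and `ρ` is the probability of a departure. -/
lemma lintegral_exp_drift_sum_le {ε : ℝ} {g ρ : ℕ → Ω → ℝ} (s n : ℕ) (hs : 1 ≤ s)
    (hg : ∀ t, s ≤ t → t < n → Measurable[M.ℱ t] (g t))
    (hρ : ∀ t, s ≤ t → t < n → Measurable[M.ℱ t] (ρ t))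
    (hg01 : ∀ t ω, g t ω ∈ Set.Icc (0 : ℝ) 1) (hρ01 : ∀ t ω, ρ t ω ∈ Set.Icc (0 : ℝ) 1) :
    ∫⁻ ω, ENNReal.ofReal (Real.exp (ε * ∑ t ∈ Finset.Ico s n,
      g t ω * (M.arrival t ω - M.lam - M.noise t (ρ t ω) ω - ε / 2))) ∂M.P ≤ 1 := by
  have := M.isProb
  set Y : ℕ → Ω → ℝ := fun t ω =>
    g t ω * (M.arrival t ω - M.lam - M.noise t (ρ t ω) ω - ε / 2) with hY
  have hYm : ∀ t, s ≤ t → t < n → Measurable[M.ℱ (t + 1)] (Y t) := fun t h1 h2 => by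
    have hA : Measurable[M.ℱ (t + 1)] (M.arrival t) :=
      Measurable.ite (M.arr_meas t (by omega) (measurableSet_singleton true))
        measurable_const measurable_const
    exact ((hg t h1 h2).mono (M.ℱ.mono (by omega)) le_rfl).mul
      (((hA.sub_const _).sub (measurable_noise (by omega) (hρ t h1 h2))).sub_const _)
  induction n with
  | zero => simp
  | succ n ih =>
    rcases Nat.lt_or_ge n s with h | h
    · rw [Finset.Ico_eq_empty (by omega)]; simp
    · refine le_trans ?_ (ih (fun t h1 h2 => hg t h1 (by omega))
        (fun t h1 h2 => hρ t h1 (by omega)) (fun t h1 h2 => hYm t h1 (by omega)))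
      have hS : Measurable[M.ℱ n] fun ω => ∑ t ∈ Finset.Ico s n, Y t ω := by
        refine Finset.measurable_sum _ fun t ht => ?_
        rw [Finset.mem_Ico] at ht
        exact (hYm t ht.1 (by omega)).mono (M.ℱ.mono (by omega)) le_rfl
      simp only [Finset.sum_Ico_succ_top h, mul_add]
      obtain ⟨X, hX⟩ : ∃ X : (ℝ × ℝ × ℝ) × (Bool × ℝ) → ℝ, X = fun p =>
          (if p.2.1 = true then 1 else 0) - M.lam
            - ((if p.2.2 ≤ p.1.2.2 then 1 else 0) - p.1.2.2) := ⟨_, rfl⟩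
      have hXm : Measurable X := by
        rw [hX]
        refine Measurable.sub (Measurable.sub_const (Measurable.ite ?_ measurable_const
          measurable_const) _) (Measurable.sub (Measurable.ite (measurableSet_le ?_ ?_)
          measurable_const measurable_const) ?_)
        · exact (measurable_fst.comp measurable_snd) (measurableSet_singleton true)
        all_goals fun_prop
      have hf : Measurable fun p : (ℝ × ℝ × ℝ) × (Bool × ℝ) =>
          ENNReal.ofReal (Real.exp (ε * p.1.1 + ε * (p.1.2.1 * (X p - ε / 2)))) := by
        fun_prop
      rw [hX] at hf
      refine Model.lintegral_le_of_past (by omega)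
        (W := fun ω => (∑ t ∈ Finset.Ico s n, Y t ω, g n ω, ρ n ω))
        (hS.prodMk ((hg n h (by omega)).prodMk (hρ n h (by omega)))) hf fun ω => ?_
      obtain ⟨hg0, hg1⟩ := hg01 n ω
      calc _ = ∫⁻ ω', ENNReal.ofReal (Real.exp (ε * ∑ t ∈ Finset.Ico s n, Y t ω
              - ε ^ 2 * g n ω / 2)) * ENNReal.ofReal (Real.exp (ε * g n ω *
              (M.arrival n ω' - M.lam - M.noise n (ρ n ω) ω'))) ∂M.P := by
            refine lintegral_congr fun ω' => ?_
            rw [← ENNReal.ofReal_mul (Real.exp_pos _).le, ← Real.exp_add]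
            congr 2
            simp only [Model.arrival, Model.noise]
            ring
        _ = ENNReal.ofReal (Real.exp (ε * ∑ t ∈ Finset.Ico s n, Y t ω
              - ε ^ 2 * g n ω / 2)) * ∫⁻ ω', ENNReal.ofReal (Real.exp (ε * g n ω *
              (M.arrival n ω' - M.lam - M.noise n (ρ n ω) ω'))) ∂M.P :=
            lintegral_const_mul' _ _ ENNReal.ofReal_ne_top
        _ ≤ ENNReal.ofReal (Real.exp (ε * ∑ t ∈ Finset.Ico s n, Y t ω
              - ε ^ 2 * g n ω / 2)) * ENNReal.ofReal (Real.exp ((ε * g n ω) ^ 2 / 2)) := by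
            gcongr
            exact Model.lintegral_exp_drift_le (by omega) (hρ01 n ω) _
        _ ≤ ENNReal.ofReal (Real.exp (ε * ∑ t ∈ Finset.Ico s n, Y t ω)) := by
            rw [← ENNReal.ofReal_mul (Real.exp_pos _).le, ← Real.exp_add]
            refine ENNReal.ofReal_le_ofReal (Real.exp_le_exp.2 ?_)
            have : ε ^ 2 * g n ω ^ 2 ≤ ε ^ 2 * g n ω := by
              gcongr
              nlinarith
            nlinarith

lemma measure_drift_sum_gt_le {ε x : ℝ} (hε : 0 < ε) {g ρ : ℕ → Ω → ℝ} (s n : ℕ) (hs : 1 ≤ s)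
    (hg : ∀ t, s ≤ t → t < n → Measurable[M.ℱ t] (g t))
    (hρ : ∀ t, s ≤ t → t < n → Measurable[M.ℱ t] (ρ t))
    (hg01 : ∀ t ω, g t ω ∈ Set.Icc (0 : ℝ) 1) (hρ01 : ∀ t ω, ρ t ω ∈ Set.Icc (0 : ℝ) 1) :
    M.P {ω | x < ∑ t ∈ Finset.Ico s n,
      g t ω * (M.arrival t ω - M.lam - M.noise t (ρ t ω) ω - ε / 2)} ≤
      ENNReal.ofReal (Real.exp (-(ε * x))) := by
  have hm : Measurable fun ω => ∑ t ∈ Finset.Ico s n,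
      g t ω * (M.arrival t ω - M.lam - M.noise t (ρ t ω) ω - ε / 2) := by
    refine Finset.measurable_sum _ fun t ht => ?_
    rw [Finset.mem_Ico] at ht
    have hA : Measurable (M.arrival t) :=
      Measurable.ite ((M.arr_meas t (by omega)).mono (M.ℱ.le _) le_rfl
        (measurableSet_singleton true)) measurable_const measurable_const
    exact ((hg t ht.1 ht.2).mono (M.ℱ.le _) le_rfl).mul
      (((hA.sub_const _).sub ((measurable_noise (by omega) (hρ t ht.1 ht.2)).mono (M.ℱ.le _)
        le_rfl)).sub_const _)
  have h := lintegral_exp_drift_sum_le (ε := ε) s n hs hg hρ hg01 hρ01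
  have hc : 0 < Real.exp (ε * x) := Real.exp_pos _
  refine (measure_mono fun ω hω => ?_).trans ((meas_ge_le_lintegral_div
    (hm.const_mul ε).exp.ennreal_ofReal.aemeasurable (by simpa using hc)
    ENNReal.ofReal_ne_top).trans ((ENNReal.div_le_div_right h _).trans_eq ?_))
  · exact ENNReal.ofReal_le_ofReal (Real.exp_le_exp.2
      (mul_le_mul_of_nonneg_left (le_of_lt hω) hε.le))
  · rw [← ENNReal.ofReal_one, ← ENNReal.ofReal_div_of_pos hc, Real.exp_neg, one_div]

end Supermartingale

/-! ### The queue of a run -/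

section Queue

variable {d K : ℕ} {Ω : Type*} [mΩ : MeasurableSpace Ω] {M : Model d K Ω} {T : ℕ}

namespace Run

/-- The indicator of a nonempty queue in round `t`. -/
def busy (R : Run M T) (t : ℕ) (ω : Ω) : ℝ := if (R.queue t ω).Nonempty then 1 else 0

/-- The probability of a departure in round `t`, which is `0` if the queue is empty. -/
def chosenRate (R : Run M T) (t : ℕ) (ω : Ω) : ℝ :=
  if (R.queue t ω).Nonempty then rate (M.θ (R.server t ω)) (M.feat (R.job t ω) ω) else 0

/-- The feature on which server `k` works in round `t`, and `0` in the rounds in which it does not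
work. In contrast to `Run.chosen` it never refers to a job that has not arrived, hence is
predictable. -/
def served (R : Run M T) (k : Fin K) (t : ℕ) (ω : Ω) : Vec d :=
  if (R.queue t ω).Nonempty then (if R.server t ω = k then M.feat (R.job t ω) ω else 0) else 0

variable (R : Run M T)

lemma mem_queue {t : ℕ} (h1 : 1 ≤ t) (hT : t ≤ T + 1) {ω : Ω} {j : ℕ} (hj : j ∈ R.queue t ω) :
    j < M.q₀ ∨ ∃ s, 1 ≤ s ∧ s < t ∧ j = M.q₀ + s := by
  induction t, h1 using Nat.le_induction with
  | base =>
    rw [R.queue_one] at hj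
    exact Or.inl (Finset.mem_range.1 hj)
  | succ t h1 ih =>
    rw [R.queue_succ t h1 (by omega), Finset.mem_union] at hj
    rcases hj with hj | hj
    · have hj' : j ∈ R.queue t ω := by
        split_ifs at hj
        · exact Finset.mem_of_mem_erase hj
        · exact hj
      rcases ih (by omega) hj' with h | ⟨s, hs, hst, h⟩
      · exact Or.inl h
      · exact Or.inr ⟨s, hs, by omega, h⟩
    · split_ifs at hj
      · exact Or.inr ⟨t, h1, by omega, Finset.mem_singleton.1 hj⟩
      · simp at hj

lemma queue_subset_range {t : ℕ} (h1 : 1 ≤ t) (hT : t ≤ T + 1) (ω : Ω) :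
    R.queue t ω ⊆ Finset.range (M.q₀ + t) := fun j hj => by
  rw [Finset.mem_range]
  rcases R.mem_queue h1 hT hj with h | ⟨s, -, hst, h⟩ <;> omega

lemma card_queue_le {t : ℕ} (h1 : 1 ≤ t) (hT : t ≤ T + 1) (ω : Ω) :
    (R.queue t ω).card ≤ M.q₀ + t := by
  simpa using Finset.card_le_card (R.queue_subset_range h1 hT ω)

lemma measurable_feat {t j : ℕ} (h1 : 1 ≤ t)
    (hj : j < M.q₀ ∨ ∃ s, 1 ≤ s ∧ s < t ∧ j = M.q₀ + s) : Measurable[M.ℱ t] (M.feat j) := by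
  rcases hj with h | ⟨s, hs, hst, rfl⟩
  · exact (M.feat_init j h).mono (M.ℱ.mono h1) le_rfl
  · exact (M.feat_arr s hs).mono (M.ℱ.mono (by omega)) le_rfl

lemma measurableSet_mem_queue {t : ℕ} (h1 : 1 ≤ t) (hT : t ≤ T + 1) (j : ℕ) :
    MeasurableSet[M.ℱ t] {ω | j ∈ R.queue t ω} := by
  induction t, h1 using Nat.le_induction generalizing j with
  | base => simp only [R.queue_one]; exact MeasurableSet.const _
  | succ t h1 ih =>
    have hle : M.ℱ t ≤ M.ℱ (t + 1) := M.ℱ.mono (Nat.le_succ t)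
    have e : {ω | j ∈ R.queue (t + 1) ω} =
        ({ω | j ∈ R.queue t ω} \ ({ω | j ∈ R.queue t ω} ∩
          {ω | R.job t ω = j ∧ M.srv t ω ≤ rate (M.θ (R.server t ω)) (M.feat j ω)})) ∪
        {ω | M.arr t ω = true ∧ j = M.q₀ + t} := by
      ext ω
      simp only [Set.mem_union, Set.mem_sdiff, Set.mem_inter_iff, Set.mem_ofPred_eq,
        R.queue_succ t h1 (by omega), Finset.mem_union]
      refine or_congr ?_ ?_
      · by_cases hjob : R.job t ω = j
        · subst hjob
          split_ifs with h <;> simp [h]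
        · have : j ≠ R.job t ω := fun h => hjob h.symm
          split_ifs <;> simp [hjob, this]
      · split_ifs with h <;> simp [h]
    have hq : MeasurableSet[M.ℱ (t + 1)] {ω | j ∈ R.queue t ω} := hle _ (ih (by omega) j)
    have hA : MeasurableSet[M.ℱ (t + 1)] {ω | M.arr t ω = true ∧ j = M.q₀ + t} :=
      ((M.arr_meas t h1) (measurableSet_singleton true)).inter (MeasurableSet.const _)
    rw [e]
    refine (hq.diff ?_).union hA
    by_cases hj : j < M.q₀ ∨ ∃ s, 1 ≤ s ∧ s < t ∧ j = M.q₀ + s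
    · refine hq.inter (MeasurableSet.inter ?_ ?_)
      · exact hle _ (R.job_meas t h1 (by omega) (measurableSet_singleton j))
      · have hθ : Measurable[M.ℱ t] fun ω => M.θ (R.server t ω) :=
          measurable_from_top.comp (R.server_meas t h1 (by omega))
        exact measurableSet_le (M.srv_meas t h1)
          ((measurable_rate (measurable_feat h1 hj) hθ).mono hle le_rfl)
    · have : {ω | j ∈ R.queue t ω} = ∅ := Set.eq_empty_of_forall_notMem fun ω h =>
        hj (R.mem_queue h1 (by omega) h)
      rw [this, Set.empty_inter]
      exact @MeasurableSet.empty _ (M.ℱ (t + 1))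

lemma measurableSet_nonempty_queue {t : ℕ} (h1 : 1 ≤ t) (hT : t ≤ T + 1) :
    MeasurableSet[M.ℱ t] {ω | (R.queue t ω).Nonempty} := by
  have e : {ω | (R.queue t ω).Nonempty} = ⋃ j, {ω | j ∈ R.queue t ω} := by
    ext ω; simp [Finset.Nonempty]
  rw [e]
  exact MeasurableSet.iUnion fun j => R.measurableSet_mem_queue h1 hT j

lemma measurable_card_queue {t : ℕ} (h1 : 1 ≤ t) (hT : t ≤ T + 1) :
    Measurable fun ω => ((R.queue t ω).card : ℝ) := by
  have e : (fun ω => ((R.queue t ω).card : ℝ)) =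
      fun ω => ∑ j ∈ Finset.range (M.q₀ + t), if j ∈ R.queue t ω then (1 : ℝ) else 0 := by
    ext ω
    rw [← Finset.sum_filter, Finset.filter_mem_eq_inter,
      Finset.inter_eq_right.2 (R.queue_subset_range h1 hT ω)]
    simp
  rw [e]
  exact Finset.measurable_sum _ fun j _ => Measurable.ite
    (M.ℱ.le t _ (R.measurableSet_mem_queue h1 hT j)) measurable_const measurable_const

/-- Quantities that depend on the chosen job are predictable. -/
lemma measurable_of_job {E : Type*} [AddCommMonoid E] [MeasurableSpace E] [MeasurableAdd₂ E]
    {F : ℕ → Ω → E} {t : ℕ} (h1 : 1 ≤ t) (hT : t ≤ T)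
    (hF : ∀ j, (j < M.q₀ ∨ ∃ s, 1 ≤ s ∧ s < t ∧ j = M.q₀ + s) → Measurable[M.ℱ t] (F j)) :
    Measurable[M.ℱ t] fun ω => if (R.queue t ω).Nonempty then F (R.job t ω) ω else 0 := by
  have e : (fun ω => if (R.queue t ω).Nonempty then F (R.job t ω) ω else 0) =
      fun ω => ∑ j ∈ Finset.range (M.q₀ + t),
        if j ∈ R.queue t ω ∧ R.job t ω = j then F j ω else 0 := by
    ext ω
    by_cases hne : (R.queue t ω).Nonempty
    · have hm := R.job_mem t h1 hT ω hne
      rw [if_pos hne, Finset.sum_eq_single (R.job t ω)]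
      · rw [if_pos ⟨hm, rfl⟩]
      · exact fun j _ hj => if_neg fun h => hj h.2.symm
      · exact fun h => absurd (R.queue_subset_range h1 (by omega) ω hm) h
    · rw [if_neg hne, Finset.sum_eq_zero]
      exact fun j _ => if_neg fun h => hne ⟨j, h.1⟩
  rw [e]
  refine Finset.measurable_sum _ fun j _ => ?_
  by_cases hj : j < M.q₀ ∨ ∃ s, 1 ≤ s ∧ s < t ∧ j = M.q₀ + s
  · exact Measurable.ite ((R.measurableSet_mem_queue h1 (by omega) j).inter
      (R.job_meas t h1 hT (measurableSet_singleton j))) (hF j hj) measurable_const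
  · have : ∀ ω, ¬ (j ∈ R.queue t ω ∧ R.job t ω = j) :=
      fun ω h => hj (R.mem_queue h1 (by omega) h.1)
    simp only [this, if_false]
    exact measurable_const

lemma measurable_busy {t : ℕ} (h1 : 1 ≤ t) (hT : t ≤ T) : Measurable[M.ℱ t] (R.busy t) :=
  Measurable.ite (R.measurableSet_nonempty_queue h1 (by omega)) measurable_const measurable_const

lemma measurable_chosenRate {t : ℕ} (h1 : 1 ≤ t) (hT : t ≤ T) :
    Measurable[M.ℱ t] (R.chosenRate t) :=
  R.measurable_of_job h1 hT (F := fun j ω => rate (M.θ (R.server t ω)) (M.feat j ω))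
    fun _ hj => measurable_rate (measurable_feat h1 hj)
      (measurable_from_top.comp (R.server_meas t h1 hT))

lemma measurable_served (k : Fin K) {t : ℕ} (h1 : 1 ≤ t) (hT : t ≤ T) :
    Measurable[M.ℱ t] (R.served k t) :=
  R.measurable_of_job h1 hT (F := fun j ω => if R.server t ω = k then M.feat j ω else 0)
    fun _ hj => Measurable.ite (R.server_meas t h1 hT (measurableSet_singleton k))
      (measurable_feat h1 hj) measurable_const

lemma busy_mem (t : ℕ) (ω : Ω) : R.busy t ω ∈ Set.Icc (0 : ℝ) 1 := by
  rw [busy]; split_ifs <;> simp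

lemma chosenRate_mem (t : ℕ) (ω : Ω) : R.chosenRate t ω ∈ Set.Icc (0 : ℝ) 1 := by
  rw [chosenRate]
  split_ifs
  · exact ⟨rate_nonneg _ _, rate_le_one _ _⟩
  · simp

/-- The queue length is bounded by the net input since the last round `s` in which the queue was
empty (or since the first round). -/
lemma exists_card_queue_le {n : ℕ} (h1 : 1 ≤ n) (hT : n ≤ T) (ω : Ω) :
    ∃ s, 1 ≤ s ∧ s ≤ n ∧ ((R.queue n ω).card : ℝ) ≤ M.q₀ + 1 + ∑ t ∈ Finset.Ico s n,
      R.busy t ω * (M.arrival t ω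
        - (M.noise t (R.chosenRate t ω) ω + R.chosenRate t ω)) := by
  induction n, h1 using Nat.le_induction with
  | base => exact ⟨1, le_rfl, le_rfl, by simp [R.queue_one]⟩
  | succ n h1 ih =>
    have hA : (((if M.arr n ω = true then {M.q₀ + n} else ∅ : Finset ℕ).card : ℕ) : ℝ)
        = M.arrival n ω := by
      rw [Model.arrival]; split_ifs <;> simp
    have hA1 : M.arrival n ω ≤ 1 := by rw [Model.arrival]; split_ifs <;> simp
    have hu : ((R.queue (n + 1) ω).card : ℝ) ≤
        ((if M.srv n ω ≤ rate (M.θ (R.server n ω)) (M.feat (R.job n ω) ω)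
          then (R.queue n ω).erase (R.job n ω) else R.queue n ω).card : ℝ)
        + M.arrival n ω := by
      rw [← hA, R.queue_succ n h1 (by omega)]
      exact_mod_cast Finset.card_union_le _ _
    by_cases hne : (R.queue n ω).Nonempty
    · obtain ⟨s, hs1, hsn, h⟩ := ih (by omega)
      refine ⟨s, hs1, by omega, ?_⟩
      rw [Finset.sum_Ico_succ_top hsn, busy, if_pos hne, Model.noise, chosenRate, if_pos hne]
      have hm := R.job_mem n h1 (by omega) ω hne
      split_ifs at hu ⊢ with hd
      · rw [Finset.card_erase_of_mem hm, Nat.cast_sub (Finset.card_pos.2 hne)] at hu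
        push_cast at hu
        linarith
      · linarith
    · refine ⟨n + 1, by omega, le_rfl, ?_⟩
      have he := Finset.not_nonempty_iff_eq_empty.1 hne
      have : (0 : ℝ) ≤ M.q₀ := Nat.cast_nonneg _
      simp only [he, Finset.erase_empty, ite_self, Finset.card_empty, Nat.cast_zero] at hu
      rw [Finset.Ico_self, Finset.sum_empty]
      linarith

lemma design_obs (κ lam₀ : ℝ) (n : ℕ) (k : Fin K) (ω : Ω) :
    design κ lam₀ (R.obs ω n k) (R.chosen ω) =
      design κ lam₀ (Finset.Icc 1 n) fun i => R.served k i ω := by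
  rw [design, design, obs, Finset.sum_filter]
  congr 1
  refine Finset.sum_congr rfl fun i _ => ?_
  rw [served, chosen]
  by_cases h1 : (R.queue i ω).Nonempty <;> by_cases h2 : R.server i ω = k <;> simp [h1, h2]

lemma sum_feedback_eq_noiseSum (n : ℕ) (k : Fin K) (ω : Ω) :
    ∑ i ∈ R.obs ω n k, (R.feedback ω i - rate (M.θ k) (R.chosen ω i)) • R.chosen ω i =
      noiseSum M (M.θ k) (R.served k) n ω := by
  rw [noiseSum, obs, Finset.sum_filter]
  refine Finset.sum_congr rfl fun i _ => ?_
  rw [served, feedback, chosen, Model.noise]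
  by_cases h1 : (R.queue i ω).Nonempty <;> by_cases h2 : R.server i ω = k <;> simp [h1, h2]

end Run

end Queue

/-! ### Regret of the optimistic algorithm -/

section Regret

variable {d K : ℕ} {Ω : Type*} [mΩ : MeasurableSpace Ω] {M : Model d K Ω} {T : ℕ}
  {𝒳 : Set (Vec d)} {S κ lam₀ δ ε : ℝ}

namespace Run

/-- The event that the confidence set of server `k` is valid after round `n`. -/
def Confident (R : Run M T) (κ lam₀ δ : ℝ) (n : ℕ) (k : Fin K) (ω : Ω) : Prop :=
  invNorm (design κ lam₀ (Finset.Icc 1 n) fun i => R.served k i ω)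
      (noiseSum M (M.θ k) (R.served k) n ω) ^ 2 ≤
    Real.log (design κ lam₀ (Finset.Icc 1 n) fun i => R.served k i ω).det
      - Real.log ((κ * lam₀) ^ d) + Real.log (K / δ)

variable {R : Run M T}

/-- Optimism: the rate of the chosen pair misses the guaranteed rate `λ + ε` by at most twice the
confidence width of the chosen pair, and never by more than `1`. -/
lemma slack_sub_chosenRate_le (hd : 1 ≤ d) (hκ : 1 ≤ κ) (hlam₀ : 0 < lam₀)
    (hM : M.Assumptions 𝒳 S κ ε) (hR : R.IsCQBOpt S κ lam₀ δ) {t : ℕ} (h1 : 1 ≤ t) (hT : t ≤ T)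
    {ω : Ω} (hne : (R.queue t ω).Nonempty)
    (hc : ∀ k, R.Confident κ lam₀ δ (t - 1) k ω) :
    M.lam + ε - R.chosenRate t ω ≤ min 1 (2 * radius d K S κ lam₀ δ
        (R.obs ω (t - 1) (R.server t ω)).card *
      invNorm (design κ lam₀ (Finset.Icc 1 (t - 1)) fun i => R.served (R.server t ω) i ω)
        (R.served (R.server t ω) t ω)) := by
  obtain ⟨est, hest⟩ := hR
  obtain ⟨hE, hmax⟩ := hest t h1 hT ω
  have hj := R.job_mem t h1 hT ω hne
  obtain ⟨k, hk⟩ := hM.slack _ (hM.feat_mem (R.job t ω) ω)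
  have hserved : R.served (R.server t ω) t ω = M.feat (R.job t ω) ω := by
    rw [served, if_pos hne, if_pos rfl]
  have hrate : R.chosenRate t ω = rate (M.θ (R.server t ω)) (M.feat (R.job t ω) ω) := by
    rw [chosenRate, if_pos hne]
  have hacc : ∀ l x, |rate (est (t - 1) l ω) x - rate (M.θ l) x| ≤
      radius d K S κ lam₀ δ (R.obs ω (t - 1) l).card *
        invNorm (design κ lam₀ (R.obs ω (t - 1) l) (R.chosen ω)) x := fun l x => by
    refine abs_rate_sub_le_radius hd hκ hlam₀ (hE l) (hM.norm_param l)
      (fun i _ => hM.norm_feat _ (hM.feat_mem _ _))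
      (fun i _ => hM.deriv_lower _ (hM.feat_mem _ _)) ?_ x
    rw [sum_feedback_eq_noiseSum, design_obs, det_design_empty]
    exact hc l
  refine le_min ?_ ?_
  · linarith [rate_le_one (M.θ k) (M.feat (R.job t ω) ω), (R.chosenRate_mem t ω).1]
  · have h2 := hmax _ hj k
    have h3 := abs_le.1 (hacc k (M.feat (R.job t ω) ω))
    have h4 := abs_le.1 (hacc (R.server t ω) (M.feat (R.job t ω) ω))
    rw [ucb, ucb, chosen] at h2
    rw [hserved, hrate, ← design_obs]
    linarith [h3.1, h4.2]

/-- On the event that all confidence sets are valid and that the noise of the drift stays below `x`,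
the queue at time `T` is short. The contribution of a round whose confidence width is `w` is at
most `w - ε / 2 ≤ w² / (2 ε)`, and the squared widths are summed by the elliptical potential
lemma. -/
lemma card_queue_le_of_confident (hd : 1 ≤ d) (hκ : 1 ≤ κ) (hlam₀ : 0 < lam₀) (hε : 0 < ε)
    (hM : M.Assumptions 𝒳 S κ ε) (hR : R.IsCQBOpt S κ lam₀ δ) (hT : 1 ≤ T) {ω : Ω} {x B : ℝ}
    (hc : ∀ n < T, ∀ k, R.Confident κ lam₀ δ n k ω)
    (hx : ∀ s, 1 ≤ s → s ≤ T → ∑ t ∈ Finset.Ico s T, R.busy t ω *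
      (M.arrival t ω - M.lam - M.noise t (R.chosenRate t ω) ω - ε / 2) ≤ x)
    (hB : ∀ n ≤ T, 1 + 4 * radius d K S κ lam₀ δ n ^ 2 ≤ B) :
    ((R.queue T ω).card : ℝ) ≤ M.q₀ + 1 + x
      + K * B * (d * Real.log (1 + T / (κ * lam₀ * d))) / ε := by
  have hκ0 : 0 < κ := by linarith
  set a : ℕ → Fin K → ℝ := fun t k =>
    invNorm (design κ lam₀ (Finset.Icc 1 (t - 1)) fun i => R.served k i ω) (R.served k t ω) ^ 2
    with ha
  have ha0 : ∀ t k, 0 ≤ a t k := fun t k => sq_nonneg _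
  have hB0 : 0 ≤ B := le_trans (by positivity) (hB 0 (Nat.zero_le _))
  have hm0 : ∀ t k, 0 ≤ min 1 (a t k) := fun t k => le_min zero_le_one (ha0 t k)
  obtain ⟨s, hs1, hsT, hQ⟩ := R.exists_card_queue_le hT le_rfl ω
  have hround : ∀ t ∈ Finset.Ico s T, R.busy t ω * (M.arrival t ω
        - (M.noise t (R.chosenRate t ω) ω + R.chosenRate t ω)) ≤
      R.busy t ω * (M.arrival t ω - M.lam - M.noise t (R.chosenRate t ω) ω - ε / 2)
        + ∑ k, B / (2 * ε) * min 1 (a t k) := fun t ht => by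
    rw [Finset.mem_Ico] at ht
    have hsum0 : ∀ k, 0 ≤ B / (2 * ε) * min 1 (a t k) := fun k =>
      mul_nonneg (by positivity) (hm0 t k)
    by_cases hne : (R.queue t ω).Nonempty
    · have hw := slack_sub_chosenRate_le hd hκ hlam₀ hM hR (by omega) (by omega) hne
        (hc (t - 1) (by omega))
      set k := R.server t ω
      set β := radius d K S κ lam₀ δ (R.obs ω (t - 1) k).card
      set v := invNorm (design κ lam₀ (Finset.Icc 1 (t - 1)) fun i => R.served k i ω)
        (R.served k t ω) with hv
      have hcard : (R.obs ω (t - 1) k).card ≤ T := by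
        refine (Finset.card_filter_le _ _).trans ?_
        rw [Nat.card_Icc]; omega
      have hβ := hB _ hcard
      -- the squared width, truncated at `1`, is at most `B` times the truncated potential
      have hsq : min 1 (2 * β * v) ^ 2 ≤ B * min 1 (a t k) ∨ min 1 (2 * β * v) ≤ 0 := by
        rcases le_or_gt (min 1 (2 * β * v)) 0 with h | h
        · exact Or.inr h
        · left
          have h1 : min 1 (2 * β * v) ≤ 1 := min_le_left _ _
          have h2 : min 1 (2 * β * v) ≤ 2 * β * v := min_le_right _ _
          have hs1 : min 1 (2 * β * v) ^ 2 ≤ 1 := pow_le_one₀ h.le h1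
          have hs2 : min 1 (2 * β * v) ^ 2 ≤ (2 * β * v) ^ 2 := pow_le_pow_left₀ h.le h2 2
          rcases le_total 1 (a t k) with h3 | h3
          · rw [min_eq_left h3]
            nlinarith [sq_nonneg β]
          · rw [min_eq_right h3]
            have : a t k = v ^ 2 := rfl
            rw [this]
            nlinarith [sq_nonneg v, sq_nonneg β, mul_le_mul_of_nonneg_right hβ (sq_nonneg v)]
      have hgap : M.lam + ε / 2 - R.chosenRate t ω ≤ B / (2 * ε) * min 1 (a t k) := by
        have e : B / (2 * ε) * min 1 (a t k) = (B * min 1 (a t k)) / (2 * ε) := by ring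
        set w := min 1 (2 * β * v)
        rcases hsq with h | h
        · have h1 : w - ε / 2 ≤ w ^ 2 / (2 * ε) := by
            rw [le_div_iff₀ (by positivity)]
            nlinarith [sq_nonneg (w - ε)]
          have h2 : w ^ 2 / (2 * ε) ≤ (B * min 1 (a t k)) / (2 * ε) := by gcongr
          rw [e]; linarith
        · linarith [hsum0 k]
      have hle : B / (2 * ε) * min 1 (a t k) ≤ ∑ k, B / (2 * ε) * min 1 (a t k) :=
        Finset.single_le_sum (f := fun k => B / (2 * ε) * min 1 (a t k))
          (fun k _ => hsum0 k) (Finset.mem_univ k)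
      rw [busy, if_pos hne]
      linarith
    · rw [busy, if_neg hne, zero_mul, zero_mul, zero_add]
      exact Finset.sum_nonneg fun k _ => hsum0 k
  have hpot : ∀ k, ∑ t ∈ Finset.Ico s T, min 1 (a t k) ≤
      2 * (d * Real.log (1 + T / (κ * lam₀ * d))) := fun k => by
    have hdet := log_det_design_le (I := Finset.Icc 1 T) (z := fun i => R.served k i ω) hd hκ0
      hlam₀ fun i _ => by
        rw [served]
        split_ifs
        · exact hM.norm_feat _ (hM.feat_mem _ _)
        · simp
        · simp
    have hell := sum_min_invNorm_sq_le hκ0 hlam₀ T fun i => R.served k i ω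
    have hsub : ∑ t ∈ Finset.Ico s T, min 1 (a t k) ≤ ∑ t ∈ Finset.Icc 1 T, min 1 (a t k) := by
      refine Finset.sum_le_sum_of_subset_of_nonneg (fun t ht => ?_) fun t _ _ => hm0 t k
      rw [Finset.mem_Ico] at ht
      exact Finset.mem_Icc.2 ⟨by omega, by omega⟩
    rw [Nat.card_Icc, Nat.add_sub_cancel] at hdet
    linarith
  have hsum : ∑ t ∈ Finset.Ico s T, ∑ k, B / (2 * ε) * min 1 (a t k) ≤
      K * B * (d * Real.log (1 + T / (κ * lam₀ * d))) / ε := by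
    rw [Finset.sum_comm]
    calc ∑ k, ∑ t ∈ Finset.Ico s T, B / (2 * ε) * min 1 (a t k)
        ≤ ∑ _k : Fin K, B / (2 * ε) * (2 * (d * Real.log (1 + T / (κ * lam₀ * d)))) := by
          refine Finset.sum_le_sum fun k _ => ?_
          rw [← Finset.mul_sum]
          exact mul_le_mul_of_nonneg_left (hpot k) (by positivity)
      _ = _ := by
          rw [Finset.sum_const, Finset.card_univ, Fintype.card_fin, nsmul_eq_mul]
          field_simp
  have := Finset.sum_le_sum hround
  rw [Finset.sum_add_distrib] at this
  linarith [hx s hs1 hsT]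

lemma measure_not_confident_le (hκ : 0 < κ) (hlam₀ : 0 < lam₀) (hδ : 0 < δ) (hδT : δ ≤ 1 / (T : ℝ))
    (hT : 1 ≤ T) (hK : 1 ≤ K) :
    M.P {ω | ∃ n < T, ∃ k, ¬ R.Confident κ lam₀ δ n k ω} ≤ ENNReal.ofReal (1 / T) := by
  have hK0 : (0 : ℝ) < K := by exact_mod_cast hK
  have hK1 : (1 : ℝ) ≤ K := by exact_mod_cast hK
  have hT0 : (0 : ℝ) < T := by exact_mod_cast hT
  have h : ∀ n < T, ∀ k, M.P {ω | ¬ R.Confident κ lam₀ δ n k ω} ≤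
      ENNReal.ofReal ((δ / K) ^ 2) := fun n hn k => by
    have := measure_selfNormalized_gt_le (M := M) hκ hlam₀ (M.θ k) (y := R.served k) n
      (fun t h1 h2 => R.measurable_served k h1 (by omega)) (div_pos hδ hK0)
    rw [one_div_div] at this
    simpa only [Confident, not_le] using this
  have hsub : {ω | ∃ n < T, ∃ k, ¬ R.Confident κ lam₀ δ n k ω} ⊆
      ⋃ p ∈ (Finset.range T ×ˢ (Finset.univ : Finset (Fin K))),
        {ω | ¬ R.Confident κ lam₀ δ p.1 p.2 ω} := by
    rintro ω ⟨n, hn, k, hk⟩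
    simp only [Set.mem_iUnion]
    exact ⟨(n, k), by simpa using hn, hk⟩
  calc _ ≤ ∑ p ∈ (Finset.range T ×ˢ (Finset.univ : Finset (Fin K))),
        M.P {ω | ¬ R.Confident κ lam₀ δ p.1 p.2 ω} :=
        (measure_mono hsub).trans (measure_biUnion_finset_le _ _)
    _ ≤ ∑ p ∈ (Finset.range T ×ˢ (Finset.univ : Finset (Fin K))),
        ENNReal.ofReal ((δ / K) ^ 2) := Finset.sum_le_sum fun p hp => by
          rw [Finset.mem_product, Finset.mem_range] at hp
          exact h p.1 hp.1 p.2
    _ = ENNReal.ofReal (T * K * (δ / K) ^ 2) := by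
        rw [Finset.sum_const, Finset.card_product, Finset.card_range, Finset.card_univ,
          Fintype.card_fin, nsmul_eq_mul, ENNReal.ofReal_mul (by positivity)]
        congr 1
        rw [← Nat.cast_mul, ENNReal.ofReal_natCast]
    _ ≤ ENNReal.ofReal (1 / T) := by
        refine ENNReal.ofReal_le_ofReal ?_
        have h1 : δ * T ≤ 1 := by rwa [le_div_iff₀ hT0] at hδT
        have e : T * K * (δ / K) ^ 2 = (δ * T) * δ / K := by field_simp
        rw [e, div_le_iff₀ hK0]
        calc δ * T * δ ≤ 1 * (1 / T) := by gcongr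
          _ = 1 / T * 1 := by ring
          _ ≤ 1 / T * K := by gcongr

lemma measure_drift_le (hε : 0 < ε) (hT : 1 ≤ T) :
    M.P {ω | ∃ s, 1 ≤ s ∧ s ≤ T ∧ 2 * Real.log T / ε < ∑ t ∈ Finset.Ico s T, R.busy t ω *
      (M.arrival t ω - M.lam - M.noise t (R.chosenRate t ω) ω - ε / 2)} ≤
      ENNReal.ofReal (1 / T) := by
  have hT0 : (0 : ℝ) < T := by exact_mod_cast hT
  have hsub : {ω | ∃ s, 1 ≤ s ∧ s ≤ T ∧ 2 * Real.log T / ε < ∑ t ∈ Finset.Ico s T,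
        R.busy t ω * (M.arrival t ω - M.lam - M.noise t (R.chosenRate t ω) ω - ε / 2)} ⊆
      ⋃ s ∈ Finset.Icc 1 T, {ω | 2 * Real.log T / ε < ∑ t ∈ Finset.Ico s T,
        R.busy t ω * (M.arrival t ω - M.lam - M.noise t (R.chosenRate t ω) ω - ε / 2)} := by
    rintro ω ⟨s, h1, h2, h⟩
    simp only [Set.mem_iUnion]
    exact ⟨s, Finset.mem_Icc.2 ⟨h1, h2⟩, h⟩
  calc _ ≤ ∑ s ∈ Finset.Icc 1 T, M.P {ω | 2 * Real.log T / ε < ∑ t ∈ Finset.Ico s T,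
        R.busy t ω * (M.arrival t ω - M.lam - M.noise t (R.chosenRate t ω) ω - ε / 2)} :=
        (measure_mono hsub).trans (measure_biUnion_finset_le _ _)
    _ ≤ ∑ s ∈ Finset.Icc 1 T, ENNReal.ofReal (Real.exp (-(ε * (2 * Real.log T / ε)))) :=
        Finset.sum_le_sum fun s hs => by
          rw [Finset.mem_Icc] at hs
          exact measure_drift_sum_gt_le hε s T hs.1
            (fun t h1 h2 => R.measurable_busy (by omega) h2.le)
            (fun t h1 h2 => R.measurable_chosenRate (by omega) h2.le) R.busy_mem
            R.chosenRate_mem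
    _ = ENNReal.ofReal (1 / T) := by
        have e : Real.exp (-(ε * (2 * Real.log T / ε))) = 1 / (T : ℝ) ^ 2 := by
          rw [mul_div_cancel₀ _ hε.ne', Real.exp_neg, one_div]
          congr 1
          rw [← Real.exp_log (pow_pos hT0 2), Real.log_pow]
          push_cast; ring_nf
        rw [e, Finset.sum_const, Nat.card_Icc, Nat.add_sub_cancel, nsmul_eq_mul,
          ← ENNReal.ofReal_natCast T, ← ENNReal.ofReal_mul hT0.le]
        congr 1
        field_simp

/-- The regret is at most the expected queue length of the algorithm, which is bounded by its bound
on the good event and by the trivial bound `q₀ + T` on the rest. -/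
lemma regret_le_of_confident (hd : 1 ≤ d) (hκ : 1 ≤ κ) (hlam₀ : 0 < lam₀) (hε : 0 < ε)
    (hδ : 0 < δ) (hδT : δ ≤ 1 / (T : ℝ)) (hM : M.Assumptions 𝒳 S κ ε) (hT : 1 ≤ T) (hK : 1 ≤ K)
    (hR : R.IsCQBOpt S κ lam₀ δ) (Rstar : Run M T) {B : ℝ}
    (hB : ∀ n ≤ T, 1 + 4 * radius d K S κ lam₀ δ n ^ 2 ≤ B) :
    regret R Rstar ≤ 3 * (M.q₀ + 1) + 2 * Real.log T / ε
      + K * B * (d * Real.log (1 + T / (κ * lam₀ * d))) / ε := by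
  have := M.isProb
  have hT0 : (0 : ℝ) < T := by exact_mod_cast hT
  have hT1 : (1 : ℝ) ≤ T := by exact_mod_cast hT
  have hB0 : 0 ≤ B := le_trans (by positivity) (hB 0 (Nat.zero_le _))
  have hint : ∀ R' : Run M T, Integrable (fun ω => ((R'.queue T ω).card : ℝ)) M.P := fun R' =>
    Integrable.of_mem_Icc 0 (M.q₀ + T) (R'.measurable_card_queue hT (by omega)).aemeasurable
      (Filter.Eventually.of_forall fun ω => ⟨Nat.cast_nonneg _,
        by exact_mod_cast R'.card_queue_le hT (by omega) ω⟩)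
  set N₁ := {ω | ∃ n < T, ∃ k, ¬ R.Confident κ lam₀ δ n k ω}
  set N₂ := {ω | ∃ s, 1 ≤ s ∧ s ≤ T ∧ 2 * Real.log T / ε < ∑ t ∈ Finset.Ico s T,
    R.busy t ω * (M.arrival t ω - M.lam - M.noise t (R.chosenRate t ω) ω - ε / 2)}
  set N := toMeasurable M.P (N₁ ∪ N₂)
  have hN : M.P.real N ≤ 2 / T := by
    refine ENNReal.toReal_le_of_le_ofReal (by positivity) ?_
    rw [measure_toMeasurable]
    refine (measure_union_le _ _).trans ((add_le_add
      (measure_not_confident_le (by linarith) hlam₀ hδ hδT hT hK)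
      (measure_drift_le hε hT)).trans_eq ?_)
    rw [← ENNReal.ofReal_add (by positivity) (by positivity)]
    congr 1
    ring
  set b : ℝ := M.q₀ + 1 + 2 * Real.log T / ε
    + K * B * (d * Real.log (1 + T / (κ * lam₀ * d))) / ε with hb
  have hb0 : 0 ≤ b := by
    have h1 : 0 ≤ Real.log T := Real.log_nonneg hT1
    have h2 : 0 ≤ Real.log (1 + T / (κ * lam₀ * d)) := Real.log_nonneg (by
      have : 0 ≤ (T : ℝ) / (κ * lam₀ * d) := by positivity
      linarith)
    positivity
  have hNm : MeasurableSet N := measurableSet_toMeasurable _ _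
  have hpt : ∀ ω, ((R.queue T ω).card : ℝ) ≤ b + N.indicator (fun _ => (M.q₀ + T : ℝ)) ω := by
    intro ω
    by_cases hω : ω ∈ N
    · rw [Set.indicator_of_mem hω]
      have : ((R.queue T ω).card : ℝ) ≤ M.q₀ + T := by
        exact_mod_cast R.card_queue_le hT (by omega) ω
      linarith
    · rw [Set.indicator_of_notMem hω, add_zero]
      have hω' : ω ∉ N₁ ∪ N₂ := fun h => hω (subset_toMeasurable _ _ h)
      refine card_queue_le_of_confident hd hκ hlam₀ hε hM hR hT (fun n hn k => ?_)
        (fun s h1 h2 => ?_) hB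
      · by_contra h
        exact hω' (Or.inl ⟨n, hn, k, h⟩)
      · by_contra h
        exact hω' (Or.inr ⟨s, h1, h2, not_le.1 h⟩)
  calc regret R Rstar ≤ ∫ ω, ((R.queue T ω).card : ℝ) ∂M.P := by
        rw [regret, integral_sub (hint R) (hint Rstar)]
        have : 0 ≤ ∫ ω, ((Rstar.queue T ω).card : ℝ) ∂M.P :=
          integral_nonneg fun ω => Nat.cast_nonneg _
        linarith
    _ ≤ ∫ ω, (b + N.indicator (fun _ => (M.q₀ + T : ℝ)) ω) ∂M.P :=
        integral_mono (hint R) ((integrable_const _).add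
          ((integrable_const _).indicator hNm)) hpt
    _ = b + M.P.real N * (M.q₀ + T) := by
        rw [integral_add (integrable_const _) ((integrable_const _).indicator hNm),
          integral_indicator_const _ hNm]
        simp
    _ ≤ b + 2 * (M.q₀ + 1) := by
        have h1 : M.P.real N * (M.q₀ + T) ≤ 2 / T * (M.q₀ + T) := by gcongr
        have h2 : (2 : ℝ) / T * (M.q₀ + T) ≤ 2 * (M.q₀ + 1) := by
          rw [div_mul_eq_mul_div, div_le_iff₀ hT0]
          nlinarith [(Nat.cast_nonneg M.q₀ : (0 : ℝ) ≤ M.q₀)]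
        linarith
    _ = _ := by rw [hb]; ring

end Run

end Regret

/-! ### Growth of the confidence radius -/

section Constants

/-- The constant in front of `log T` in the bound of the volume growth of the design matrix. -/
def volumeConst (κ lam₀ : ℝ) : ℝ := 1 + Real.log (1 + 1 / (κ * lam₀)) / Real.log 2

/-- The constant in front of `d log T` in the bound of the squared confidence radius. -/
def radiusConst (K : ℕ) (S κ lam₀ c : ℝ) : ℝ :=
  κ ^ 2 / 2 * (2 * volumeConst κ lam₀ + Real.log K / Real.log 2 + |c|)
    + κ ^ 2 * S ^ 2 * lam₀ / (2 * Real.log 2)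

variable {K d T n : ℕ} {S κ lam₀ δ c : ℝ}

lemma volumeConst_pos (hκ : 0 < κ) (hlam₀ : 0 < lam₀) : 0 < volumeConst κ lam₀ := by
  have h2 : 0 < Real.log 2 := Real.log_pos one_lt_two
  have h1 : 0 ≤ Real.log (1 + 1 / (κ * lam₀)) := Real.log_nonneg (by
    have : 0 ≤ 1 / (κ * lam₀) := by positivity
    linarith)
  unfold volumeConst
  positivity

lemma radiusConst_nonneg (hκ : 0 < κ) (hlam₀ : 0 < lam₀) : 0 ≤ radiusConst K S κ lam₀ c := by
  have h2 : 0 < Real.log 2 := Real.log_pos one_lt_two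
  have h1 := volumeConst_pos hκ hlam₀
  have h3 : 0 ≤ Real.log K := Real.log_natCast_nonneg K
  unfold radiusConst
  positivity

lemma log_volume_le (hκ : 0 < κ) (hlam₀ : 0 < lam₀) (hd : 1 ≤ d) (hT : 2 ≤ T) (hn : n ≤ T) :
    Real.log (1 + n / (κ * lam₀ * d)) ≤ volumeConst κ lam₀ * Real.log T := by
  have h2 : 0 < Real.log 2 := Real.log_pos one_lt_two
  have hp : 0 < κ * lam₀ := mul_pos hκ hlam₀
  have hd1 : (1 : ℝ) ≤ d := by exact_mod_cast hd
  have hT2 : (2 : ℝ) ≤ T := by exact_mod_cast hT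
  have hT0 : (0 : ℝ) < T := by linarith
  have hnT : (n : ℝ) ≤ T := by exact_mod_cast hn
  have hℓ : Real.log 2 ≤ Real.log T := Real.log_le_log two_pos hT2
  have h0 : 0 ≤ Real.log (1 + 1 / (κ * lam₀)) := Real.log_nonneg (by
    have : 0 ≤ 1 / (κ * lam₀) := by positivity
    linarith)
  have h1 : 1 + n / (κ * lam₀ * d) ≤ T * (1 + 1 / (κ * lam₀)) := by
    have : n / (κ * lam₀ * d) ≤ T / (κ * lam₀) :=
      div_le_div₀ hT0.le hnT hp (le_mul_of_one_le_right hp.le hd1)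
    rw [mul_add, mul_one, mul_one_div]
    linarith
  calc Real.log (1 + n / (κ * lam₀ * d)) ≤ Real.log (T * (1 + 1 / (κ * lam₀))) :=
        Real.log_le_log (by positivity) h1
    _ = Real.log T + Real.log (1 + 1 / (κ * lam₀)) :=
        Real.log_mul (by positivity) (by positivity)
    _ ≤ Real.log T + Real.log (1 + 1 / (κ * lam₀)) / Real.log 2 * Real.log T := by
        gcongr
        rw [div_mul_eq_mul_div, le_div_iff₀ h2]
        gcongr
    _ = _ := by rw [volumeConst]; ring

lemma radius_sq_le (hκ : 0 < κ) (hlam₀ : 0 < lam₀) (hd : 1 ≤ d) (hT : 2 ≤ T) (hn : n ≤ T)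
    (hK : 1 ≤ K) (hδ : (T : ℝ) ^ (-c) ≤ δ) :
    radius d K S κ lam₀ δ n ^ 2 ≤ radiusConst K S κ lam₀ c * (d * Real.log T) := by
  have h2 : 0 < Real.log 2 := Real.log_pos one_lt_two
  have hd1 : (1 : ℝ) ≤ d := by exact_mod_cast hd
  have hT2 : (2 : ℝ) ≤ T := by exact_mod_cast hT
  have hT0 : (0 : ℝ) < T := by linarith
  have hK0 : (0 : ℝ) < K := by exact_mod_cast hK
  have hℓ : Real.log 2 ≤ Real.log T := Real.log_le_log two_pos hT2
  have hδ0 : 0 < δ := (Real.rpow_pos_of_pos hT0 _).trans_le hδ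
  have hvol := log_volume_le hκ hlam₀ hd hT hn
  have hv := volumeConst_pos hκ hlam₀
  have hlK : 0 ≤ Real.log K := Real.log_natCast_nonneg K
  set ℓ := Real.log T
  have hdℓ : ℓ ≤ d * ℓ := le_mul_of_one_le_left (by linarith) hd1
  have hdℓ2 : Real.log 2 ≤ d * ℓ := hℓ.trans hdℓ
  have hlogδ : -(c * ℓ) ≤ Real.log δ := by
    have := Real.log_le_log (Real.rpow_pos_of_pos hT0 _) hδ
    rw [Real.log_rpow hT0] at this
    linarith
  have hlogK : Real.log (K / δ) ≤ (Real.log K / Real.log 2 + |c|) * (d * ℓ) := by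
    rw [Real.log_div hK0.ne' hδ0.ne', add_mul]
    have h3 : Real.log K ≤ Real.log K / Real.log 2 * (d * ℓ) := by
      rw [div_mul_eq_mul_div, le_div_iff₀ h2]
      gcongr
    have h4 : c * ℓ ≤ |c| * (d * ℓ) := by
      have : c * ℓ ≤ |c| * ℓ := by
        gcongr
        exact le_abs_self c
      exact this.trans (by gcongr)
    linarith
  have hX : 2 * d * Real.log (1 + n / (κ * lam₀ * d)) + Real.log (K / δ) ≤
      (2 * volumeConst κ lam₀ + Real.log K / Real.log 2 + |c|) * (d * ℓ) := by
    have : 2 * d * Real.log (1 + n / (κ * lam₀ * d)) ≤ 2 * d * (volumeConst κ lam₀ * ℓ) := by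
      gcongr
    nlinarith
  have hX0 : 0 ≤ (2 * volumeConst κ lam₀ + Real.log K / Real.log 2 + |c|) * (d * ℓ) := by
    have : 0 ≤ d * ℓ := by linarith
    positivity
  have hsq : Real.sqrt (2 * d * Real.log (1 + n / (κ * lam₀ * d)) + Real.log (K / δ)) ^ 2 ≤
      (2 * volumeConst κ lam₀ + Real.log K / Real.log 2 + |c|) * (d * ℓ) := by
    rw [← Real.sq_sqrt hX0]
    exact pow_le_pow_left₀ (Real.sqrt_nonneg _) (Real.sqrt_le_sqrt hX) 2
  have hlam : κ ^ 2 * S ^ 2 * lam₀ / 2 ≤ κ ^ 2 * S ^ 2 * lam₀ / (2 * Real.log 2) * (d * ℓ) := by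
    rw [div_mul_eq_mul_div, div_le_div_iff₀ two_pos (by positivity)]
    have : 0 ≤ κ ^ 2 * S ^ 2 * lam₀ := by positivity
    nlinarith [mul_le_mul_of_nonneg_left hdℓ2 this]
  have hl : Real.sqrt lam₀ ^ 2 = lam₀ := Real.sq_sqrt hlam₀.le
  rw [radius, radiusConst, add_mul]
  set u := Real.sqrt (2 * d * Real.log (1 + n / (κ * lam₀ * d)) + Real.log (K / δ))
  calc (κ / 2 * u + κ * S * Real.sqrt lam₀ / 2) ^ 2
      ≤ 2 * ((κ / 2 * u) ^ 2 + (κ * S * Real.sqrt lam₀ / 2) ^ 2) := add_sq_le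
    _ = κ ^ 2 / 2 * u ^ 2 + κ ^ 2 * S ^ 2 * Real.sqrt lam₀ ^ 2 / 2 := by ring
    _ ≤ κ ^ 2 / 2 * ((2 * volumeConst κ lam₀ + Real.log K / Real.log 2 + |c|) * (d * ℓ))
        + κ ^ 2 * S ^ 2 * lam₀ / (2 * Real.log 2) * (d * ℓ) := by
      rw [hl]
      gcongr
    _ = _ := by ring

end Constants

section Bounds

variable {d K : ℕ} {Ω : Type*} [mΩ : MeasurableSpace Ω] {M : Model d K Ω} {T : ℕ}
  {𝒳 : Set (Vec d)} {S κ ε : ℝ}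

lemma Model.Assumptions.slack_le_one (hM : M.Assumptions 𝒳 S κ ε) : ε ≤ 1 := by
  have := M.isProb
  obtain ⟨ω⟩ := nonempty_of_isProbabilityMeasure M.P
  obtain ⟨k, hk⟩ := hM.slack _ (hM.feat_mem 0 ω)
  have h : 0 ≤ M.lam := by rw [← M.arr_law 1 le_rfl]; exact measureReal_nonneg
  linarith [rate_le_one (M.θ k) (M.feat 0 ω)]

lemma Model.Assumptions.one_le_servers (hM : M.Assumptions 𝒳 S κ ε) : 1 ≤ K := by
  have := M.isProb
  obtain ⟨ω⟩ := nonempty_of_isProbabilityMeasure M.P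
  obtain ⟨k, -⟩ := hM.slack _ (hM.feat_mem 0 ω)
  exact (Nat.zero_le _).trans_lt k.isLt

/-- The derivative of the logistic function is at most `1 / 4`, so `κ` is at least `4`. -/
lemma Model.Assumptions.one_le_kappa (hκ : 0 < κ) (hM : M.Assumptions 𝒳 S κ ε) : 1 ≤ κ := by
  have := M.isProb
  obtain ⟨ω⟩ := nonempty_of_isProbabilityMeasure M.P
  obtain ⟨k, -⟩ := hM.slack _ (hM.feat_mem 0 ω)
  have h := (hM.deriv_lower _ (hM.feat_mem 0 ω) _ (hM.norm_param k)).trans (deriv_sigmoid_le _)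
  rw [div_le_iff₀ hκ] at h
  linarith

lemma regret_eq_zero_of_one (R Rstar : Run M 1) : regret R Rstar = 0 := by
  simp [regret, R.queue_one, Rstar.queue_one]

end Bounds

end

end ContextualQueue

open ContextualQueue in
theorem theorem2 (K q₀ : ℕ) (S κ lam₀ c : ℝ) (hκ : 0 < κ) (hlam₀ : 0 < lam₀) :
    ∃ C : ℝ, 0 < C ∧
      ∀ (d T : ℕ) (δ ε : ℝ), 1 ≤ d → 1 ≤ T → (T : ℝ) ^ (-c) ≤ δ → δ ≤ 1 / (T : ℝ) → 0 < ε →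
      ∀ (Ω : Type*) [MeasurableSpace Ω] (M : ContextualQueue.Model d K Ω)
        (𝒳 : Set (ContextualQueue.Vec d)),
        M.q₀ = q₀ → M.Assumptions 𝒳 S κ ε →
      ∀ R Rstar : ContextualQueue.Run M T,
        R.IsCQBOpt S κ lam₀ δ → Rstar.IsOptimal →
        ContextualQueue.regret R Rstar ≤
          C * ((d : ℝ) ^ 2 * Real.log T ^ 2 / ε ^ (3 / 2 : ℝ) + d * Real.log T / ε ^ 2) := by
  have h2 : 0 < Real.log 2 := Real.log_pos one_lt_two
  have hv := volumeConst_pos hκ hlam₀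
  have hr := radiusConst_nonneg (K := K) (S := S) (c := c) hκ hlam₀
  set b := 1 / Real.log 2 + 4 * radiusConst K S κ lam₀ c with hb
  have hb0 : 0 ≤ b := by positivity
  refine ⟨3 * (q₀ + 1) / Real.log 2 + 2 + K * b * volumeConst κ lam₀, by positivity, ?_⟩
  intro d T δ ε hd hT hcδ hδT hε Ω _ M 𝒳 hq hM R Rstar hR _
  have hd1 : (1 : ℝ) ≤ d := by exact_mod_cast hd
  obtain rfl | hT2 : T = 1 ∨ 2 ≤ T := by omega
  · rw [regret_eq_zero_of_one]; simp
  have hT2' : (2 : ℝ) ≤ T := by exact_mod_cast hT2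
  have hT0 : (0 : ℝ) < T := by linarith
  have hℓ : Real.log 2 ≤ Real.log T := Real.log_le_log two_pos hT2'
  have hvol := log_volume_le hκ hlam₀ hd hT2 le_rfl
  have hδ0 : 0 < δ := (Real.rpow_pos_of_pos hT0 _).trans_le hcδ
  have hε1 := hM.slack_le_one
  have hmain := Run.regret_le_of_confident (B := b * (d * Real.log T)) hd (hM.one_le_kappa hκ)
    hlam₀ hε hδ0 hδT hM hT hM.one_le_servers hR Rstar fun n hn => by
      have h1 := radius_sq_le (S := S) hκ hlam₀ hd hT2 hn hM.one_le_servers hcδ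
      have h3 : 1 ≤ 1 / Real.log 2 * (d * Real.log T) := by
        rw [one_div_mul_eq_div, le_div_iff₀ h2]
        nlinarith
      rw [hb, add_mul]
      linarith
  rw [hq] at hmain
  set ℓ := Real.log T
  have hℓ0 : 0 < ℓ := h2.trans_le hℓ
  have hdℓ : ℓ ≤ d * ℓ := le_mul_of_one_le_left hℓ0.le hd1
  -- since `ε ≤ 1`, lower powers of `1 / ε` are dominated by the powers in the claim
  have hε2 : ε ^ 2 ≤ ε := by nlinarith
  have hε32 : ε ^ (3 / 2 : ℝ) ≤ ε := by
    simpa using Real.rpow_le_rpow_of_exponent_ge hε hε1 (by norm_num : (1 : ℝ) ≤ 3 / 2)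
  have hp32 : 0 < ε ^ (3 / 2 : ℝ) := Real.rpow_pos_of_pos hε _
  have hY : d * ℓ ≤ d * ℓ / ε ^ 2 := by
    rw [le_div_iff₀ (by positivity)]
    exact mul_le_of_le_one_right (by positivity) (hε2.trans hε1)
  have t1 : 3 * ((q₀ : ℝ) + 1) ≤ 3 * (q₀ + 1) / Real.log 2 * (d * ℓ / ε ^ 2) := by
    rw [div_mul_eq_mul_div, le_div_iff₀ h2]
    gcongr
    linarith
  have t2 : 2 * ℓ / ε ≤ 2 * (d * ℓ / ε ^ 2) := by
    rw [← mul_div_assoc]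
    gcongr
  have t3 : K * (b * (d * ℓ)) * (d * Real.log (1 + T / (κ * lam₀ * d))) / ε ≤
      K * b * volumeConst κ lam₀ * (d ^ 2 * ℓ ^ 2 / ε ^ (3 / 2 : ℝ)) := by
    calc K * (b * (d * ℓ)) * (d * Real.log (1 + T / (κ * lam₀ * d))) / ε
        ≤ K * (b * (d * ℓ)) * (d * (volumeConst κ lam₀ * ℓ)) / ε ^ (3 / 2 : ℝ) := by
          gcongr
      _ = _ := by ring
  have hX0 : 0 ≤ (d : ℝ) ^ 2 * ℓ ^ 2 / ε ^ (3 / 2 : ℝ) := by positivity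
  have hY0 : 0 ≤ (d : ℝ) * ℓ / ε ^ 2 := by positivity
  have c1 : 0 ≤ 3 * ((q₀ : ℝ) + 1) / Real.log 2 := by positivity
  have c3 : 0 ≤ K * b * volumeConst κ lam₀ := by positivity
  nlinarith [mul_nonneg c1 hX0, mul_nonneg c3 hY0]
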